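/- A \emph{simple partial fraction} of order $n\ge 0$ is a rational function $\rho(x)=\sum_{k=1}^{n}\frac1{x-z_k}$ with $z_1,\dots,z_n\in\mathbb C$ not necessarily distinct ($\rho\equiv0$ if $n=0$); it is \emph{real-valued} if it takes real values on $\mathbb R$ away from its poles. For a continuous function $f:[-1,1]\to\mathbb R$ and a simple partial fraction $\rho$ without poles on $[-1,1]$ write $\|f-\rho\|=\max_{x\in[-1,1]}|f(x)-\rho(x)|$. A real-valued simple partial fraction $\rho$ of order at most $n$ without poles on $[-1,1]$ is a \emph{best approximant of $f$ (of order at most $n$)} if $\|f-\rho\|\le\|f-\tilde\rho\|$ for every real-valued simple partial fraction $\tilde\rho$ of order at most $n$ without poles on $[-1,1]$. The difference $f-\rho$ has an \emph{alternance of $m$ points} if there are points $-1\le t_1<\dots<t_m\le1$ and a sign $\sigma\in\{1,-1\}$ with $f(t_k)-\rho(t_k)=\sigma(-1)^k\|f-\rho\|$ for $k=1,\dots,m$. \textbf{Theorem.} (1) Let $n\ge0$, let $f:[-1,1]\to\mathbb R$ be continuous, and let $\rho_n$ be a real-valued simple partial fraction of order exactly $n$ all of whose poles lie outside the closed disc $|z|\le1$.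 Then $\rho_n$ is a best approximant of $f$ of order at most $n$ if and only if $f-\rho_n$ has an alternance of $n+1$ points. In that case $\rho_n$ is the unique best approximant of $f$ of order at most $n$. (2) The condition on the poles cannot be weakened, in the following sense. (a) For every $n\ge2$ and every non-real $z_0$ with $|z_0|<1$ there are a real-valued simple partial fraction $\rho_n$ of order exactly $n$, which has simple poles at $z_0$ and $\overline{z_0}$ and all its other poles outside the disc $|z|\le1$, and a continuous $f:[-1,1]\to\mathbb R$ such that $f-\rho_n$ has an alternance of $n+1$ points, but $\rho_n$ is not a best approximant of $f$ of order at most $n$. (b) For every non-real $z_0$ with $|z_0|=1$ there is a continuous $f:[-1,1]\to\mathbb R$ such that, for $\rho_2(x)=\frac1{x-z_0}+\frac1{x-\overline{z_0}}$, the difference $f-\rho_2$ has an alternance of $3$ points and $\rho_2$ is a best approximant of $f$ of order at most $2$, but it is not the only one. -/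

import Mathlib

open Set

noncomputable section

namespace SimpleFraction

/-- The simple partial fraction `ρ(x) = ∑ 1 / (x - a)`, the sum running over the multiset `z` of its
finite poles.  Its order is `z.card`; a fraction of order at most `n` is one with `z.card ≤ n`
(a pole at infinity contributes the zero summand). -/
def frac (z : Multiset ℂ) (x : ℂ) : ℂ :=
  (z.map fun a => 1 / (x - a)).sum

/-- The fraction takes real values on the real line (away from its poles). -/
def IsRealValued (z : Multiset ℂ) : Prop :=
  ∀ x : ℝ, (x : ℂ) ∉ z → (frac z x).im = 0

/-- The uniform distance between `f` and the fraction on `[-1, 1]`. It is used for `f` continuous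
on `[-1, 1]` and for fractions without poles there, so that the supremum is finite. -/
def deviation (f : ℝ → ℝ) (z : Multiset ℂ) : ℝ :=
  sSup ((fun x : ℝ => ‖(f x : ℂ) - frac z x‖) '' Icc (-1) 1)

/-- The approximating class: real-valued simple partial fractions of order at most `n`. Those with
a pole on `[-1, 1]` are unbounded there, hence infinitely far from `f`, and are left out. -/
def IsAdmissible (n : ℕ) (z : Multiset ℂ) : Prop :=
  z.card ≤ n ∧ IsRealValued z ∧ ∀ x ∈ Icc (-1 : ℝ) 1, (x : ℂ) ∉ z

/-- The fraction is a best uniform approximant of `f` on `[-1, 1]` among all real-valued simple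
partial fractions of order at most `n`. -/
def IsBest (n : ℕ) (f : ℝ → ℝ) (z : Multiset ℂ) : Prop :=
  IsAdmissible n z ∧ ∀ w : Multiset ℂ, IsAdmissible n w → deviation f z ≤ deviation f w

/-- `f - ρ` has a Chebyshev alternance of `m` points on `[-1, 1]`: at `m` increasing points it
takes the values `± ‖f - ρ‖` with alternating signs. -/
def HasAlternance (m : ℕ) (f : ℝ → ℝ) (z : Multiset ℂ) : Prop :=
  ∃ t : Fin m → ℝ, StrictMono t ∧ (∀ k, t k ∈ Icc (-1 : ℝ) 1) ∧
    ∃ σ : ℝ, (σ = 1 ∨ σ = -1) ∧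
      ∀ k : Fin m, (f (t k) : ℂ) - frac z (t k) = ((σ * (-1) ^ (k : ℕ) * deviation f z : ℝ) : ℂ)

end SimpleFraction

end

/-! A real-valued simple partial fraction is the logarithmic derivative `p'/p` of a real monic
polynomial, and `p'/p - q'/q = wr p q / (p q)` with `wr p q = p' q - p q' = q² (p/q)'`. On `[-1, 1]`
the product `p q` keeps its sign, so the nonlinear problem is governed by the linear space of
derivatives `(p/q)'`, `deg p ≤ n = deg q`, which has dimension `n` because multiples of `q`
contribute nothing. Once this space has the Haar property (`wr_eq_zero_of_zeros`: `n` zeros in `[-1,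
1]` force vanishing), the classical Chebyshev theory applies: a sign count gives sufficiency and
uniqueness (`eq_of_alternance`); perturbation, separation of convex sets and Carathéodory's theorem
give necessity (`hasAlternance_of_isBest`).

The Haar property rests on the location of the poles. Choose `r > 1` with all zeros of `q` in `|z| >
r` and put `e^τ = (r + x)/(r - x)`. The zeros of `q` move to the open left half-plane, so `q`
becomes, up to a factor, a polynomial with positive coefficients `q_k`, and `p/q` becomes a constant
times the mean of a sequence `a` under the weights `q_k e^{kτ}` on `{0, …, n}`. Let `c_j(τ)` be the
Fourier coefficients of `a` in the monic orthogonal polynomials of these weights. The Toda equations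
give `c_j' = b_{j+1} c_{j+1}` with `b_{j+1} > 0`. The mean is `c_0`, so `n` zeros of its derivative
are zeros of `c_1`, and each use of Rolle's theorem passes to the next coefficient at the cost of
one zero. If `a` is interpolated by a polynomial of degree `d ≥ 1`, then `c_d` is its nonzero
leading coefficient and yet still has a zero. Hence `a` is constant (`const_of_deriv_mean_zeros`).

For the sharpness, `wr X q = |z₀|² - x²` when `q` has the zeros `z₀` and its conjugate. If `|z₀| <
1` there are two sign changes inside the interval, and each real pole slightly to the right of `1`
adds another; an error with these signs alternates but can be improved. If `|z₀| = 1` the zeros are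
`±1`, and two different fractions can be equally good. -/

noncomputable section

namespace SimpleFraction

open Polynomial

/-! ### Simple partial fractions as logarithmic derivatives of real polynomials. -/

/-- The numerator `p' q - p q'` of the derivative of `p / q`. -/
def wr {K : Type*} [CommRing K] (p q : K[X]) : K[X] := derivative p * q - p * derivative q

/-- Multiplying by `X` makes `X p'` have top coefficient `deg p` times that of `p`, also for
constants; comparing coefficients in `(X p') q = p (X q')` at `deg p + deg q` gives equal degrees in
characteristic zero. -/
lemma natDegree_eq_of_wr_eq_zero {K : Type*} [Field K] [CharZero K] {p q : K[X]}
    (hp : p ≠ 0) (hq : q ≠ 0) (h : wr p q = 0) : p.natDegree = q.natDegree := by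
  have key : (X * derivative p) * q = p * (X * derivative q) := by
    rw [wr, sub_eq_zero] at h
    linear_combination X * h
  have hc : ∀ r : K[X], (X * derivative r).natDegree ≤ r.natDegree ∧
      (X * derivative r).coeff r.natDegree = r.natDegree * r.leadingCoeff := by
    intro r
    constructor
    · rcases Nat.eq_zero_or_pos r.natDegree with h0 | h0
      · rw [Polynomial.natDegree_eq_zero] at h0
        obtain ⟨c, rfl⟩ := h0
        simp
      · refine natDegree_mul_le.trans ?_
        have := natDegree_derivative_le r
        have := natDegree_X_le (R := K)
        omega
    · rcases Nat.eq_zero_or_pos r.natDegree with h0 | h0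
      · rw [h0]; simp
      · obtain ⟨m, hm⟩ := Nat.exists_eq_succ_of_ne_zero h0.ne'
        rw [leadingCoeff, hm, Nat.succ_eq_add_one, coeff_X_mul, coeff_derivative]
        push_cast
        ring
  have h1 := congrArg (fun r => r.coeff (p.natDegree + q.natDegree)) key
  rw [coeff_mul_add_eq_of_natDegree_le (hc p).1 le_rfl,
    coeff_mul_add_eq_of_natDegree_le le_rfl (hc q).1, (hc p).2, (hc q).2] at h1
  have hp' : p.leadingCoeff ≠ 0 := leadingCoeff_ne_zero.2 hp
  have hq' : q.leadingCoeff ≠ 0 := leadingCoeff_ne_zero.2 hq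
  have h2 : (p.natDegree : K) = q.natDegree := by
    have h3 : ((p.natDegree : K) - q.natDegree) * (p.leadingCoeff * q.leadingCoeff) = 0 := by
      have : q.coeff q.natDegree = q.leadingCoeff := rfl
      have : p.coeff p.natDegree = p.leadingCoeff := rfl
      simp only [*] at h1
      linear_combination h1
    rcases mul_eq_zero.1 h3 with h4 | h4
    · exact sub_eq_zero.1 h4
    · exact absurd h4 (mul_ne_zero hp' hq')
  exact_mod_cast h2

lemma eq_zero_of_wr_eq_zero {K : Type*} [Field K] [CharZero K] {p q : K[X]}
    (hd : p.natDegree < q.natDegree) (h : wr p q = 0) : p = 0 := by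
  by_contra hp
  have hq : q ≠ 0 := by rintro rfl; simp at hd
  exact hd.ne (natDegree_eq_of_wr_eq_zero hp hq h)

lemma wr_sub_C_mul {K : Type*} [CommRing K] (p q : K[X]) (c : K) :
    wr (p - C c * q) q = wr p q := by
  simp only [wr, derivative_sub, derivative_C_mul]
  ring

/-- Subtracting `q` from `p` leaves `wr` unchanged but lowers the degree, so a nonzero difference
would contradict equality of degrees. -/
lemma eq_of_wr_eq_zero {K : Type*} [Field K] [CharZero K] {p q : K[X]}
    (hp : p.Monic) (hq : q.Monic) (h : wr p q = 0) : p = q := by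
  have hd := natDegree_eq_of_wr_eq_zero hp.ne_zero hq.ne_zero h
  by_contra hne
  have hs : p - q ≠ 0 := sub_ne_zero.2 hne
  have h1 : wr (p - q) q = 0 := by
    have := wr_sub_C_mul p q 1
    rw [C_1, one_mul] at this
    rw [this, h]
  have hlt : (p - q).degree < p.degree :=
    degree_sub_lt_left (by rw [degree_eq_natDegree hp.ne_zero, degree_eq_natDegree hq.ne_zero, hd])
      hp.ne_zero (by rw [hp.leadingCoeff, hq.leadingCoeff])
  have := natDegree_lt_natDegree hs hlt
  exact hs (eq_zero_of_wr_eq_zero (by omega) h1)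

/-- The logarithmic derivative of a real polynomial, as a function. -/
def realFrac (p : ℝ[X]) (x : ℝ) : ℝ := (derivative p).eval x / p.eval x

lemma realFrac_sub_realFrac {p q : ℝ[X]} {x : ℝ} (hp : p.eval x ≠ 0) (hq : q.eval x ≠ 0) :
    realFrac p x - realFrac q x = (wr p q).eval x / (p.eval x * q.eval x) := by
  simp only [realFrac, wr, eval_sub, eval_mul]
  field_simp

lemma eval_map_ofReal (p : ℝ[X]) (x : ℝ) :
    (p.map (algebraMap ℝ ℂ)).eval (x : ℂ) = ((p.eval x : ℝ) : ℂ) :=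
  Polynomial.eval_map_apply (p := p) (f := algebraMap ℝ ℂ) (x := x)

lemma frac_roots (P : ℂ[X]) {x : ℂ} (hx : P.eval x ≠ 0) :
    frac P.roots x = (derivative P).eval x / P.eval x := by
  rw [(IsAlgClosed.splits P).eval_derivative_div_eval_of_ne_zero hx, frac]

lemma frac_aroots (p : ℝ[X]) {x : ℝ} (hx : p.eval x ≠ 0) :
    frac (p.aroots ℂ) x = (realFrac p x : ℂ) := by
  rw [aroots, frac_roots, derivative_map, eval_map_ofReal, eval_map_ofReal, realFrac]
  · push_cast; rfl
  · rw [eval_map_ofReal]; exact_mod_cast hx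

lemma ofReal_mem_aroots {p : ℝ[X]} (hp : p ≠ 0) {x : ℝ} :
    (x : ℂ) ∈ p.aroots ℂ ↔ p.eval x = 0 := by
  rw [aroots, mem_roots (map_ne_zero hp), IsRoot, eval_map_ofReal]
  norm_cast

lemma card_aroots (p : ℝ[X]) : (p.aroots ℂ).card = p.natDegree := by
  rw [aroots, ← (IsAlgClosed.splits _).natDegree_eq_card_roots, natDegree_map]

lemma isRealValued_aroots {p : ℝ[X]} (hp : p ≠ 0) : IsRealValued (p.aroots ℂ) := by
  intro x hx
  rw [ofReal_mem_aroots hp] at hx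
  rw [frac_aroots p hx, Complex.ofReal_im]

/-- The monic polynomial `P` with zeros `z` and its conjugate `Q` have the same logarithmic
derivative at all real points off the poles. Hence `wr P Q` has infinitely many zeros, `P = Q`, and
the coefficients are real. -/
lemma exists_real_poly {z : Multiset ℂ} (hz : IsRealValued z) :
    ∃ p : ℝ[X], p.Monic ∧ p.aroots ℂ = z := by
  set P : ℂ[X] := (z.map fun a => X - C a).prod with hP
  have hPm : P.Monic := monic_multiset_prod_of_monic _ _ fun a _ => monic_X_sub_C a
  have hPr : P.roots = z := roots_multiset_prod_X_sub_C z
  set Q : ℂ[X] := P.map (starRingEnd ℂ) with hQ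
  have hQm : Q.Monic := hPm.map _
  have hQe : ∀ x : ℝ, ∀ R : ℂ[X], (R.map (starRingEnd ℂ)).eval (x : ℂ) =
      (starRingEnd ℂ) (R.eval (x : ℂ)) := by
    intro x R
    have := Polynomial.eval_map_apply (p := R) (f := starRingEnd ℂ) (x := (x : ℂ))
    rwa [Complex.conj_ofReal] at this
  have hW : wr P Q = 0 := by
    refine eq_zero_of_infinite_isRoot _ ?_
    have hinf : ((fun x : ℝ => (x : ℂ)) '' (univ \ {x : ℝ | (x : ℂ) ∈ z})).Infinite := by
      refine Infinite.image Complex.ofReal_injective.injOn ?_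
      refine infinite_univ.sdiff ?_
      have : ((z.toFinset : Set ℂ)).Finite := Finset.finite_toSet _
      refine (this.preimage (f := fun x : ℝ => (x : ℂ)) Complex.ofReal_injective.injOn).subset ?_
      intro x hx
      simpa using hx
    refine hinf.mono ?_
    rintro _ ⟨x, ⟨-, hx⟩, rfl⟩
    have hx' : P.eval (x : ℂ) ≠ 0 := by
      intro h0
      apply hx
      have : (x : ℂ) ∈ P.roots := (mem_roots hPm.ne_zero).2 h0
      rwa [hPr] at this
    have him := hz x hx
    rw [← hPr, frac_roots P hx'] at him
    have hc := Complex.conj_eq_iff_im.2 him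
    rw [map_div₀] at hc
    have hx'' : (starRingEnd ℂ) (P.eval (x : ℂ)) ≠ 0 := by simpa using hx'
    change (wr P Q).eval (x : ℂ) = 0
    rw [div_eq_div_iff hx'' hx'] at hc
    rw [wr, eval_sub, eval_mul, eval_mul, hQ, derivative_map, hQe, hQe]
    linear_combination -hc
  have hPQ : P = Q := eq_of_wr_eq_zero hPm hQm hW
  have hlift : P ∈ lifts (algebraMap ℝ ℂ) := by
    rw [lifts_iff_coeff_lifts]
    intro k
    have : (starRingEnd ℂ) (P.coeff k) = P.coeff k := by
      conv_rhs => rw [hPQ, hQ, coeff_map]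
    exact ⟨(P.coeff k).re, Complex.conj_eq_iff_re.1 this⟩
  obtain ⟨p, hp⟩ := hlift
  have hp' : p.map (algebraMap ℝ ℂ) = P := hp
  refine ⟨p, ?_, by rw [aroots, hp', hPr]⟩
  refine monic_of_injective (algebraMap ℝ ℂ).injective ?_
  rw [hp']; exact hPm

/-! ### Orthogonal polynomials for tilted weights and their Toda equations. -/

/-- The inner product of `f` and `g` with respect to the exponentially tilted weights
`q k * exp (k τ)` on `{0, …, n}`. -/
def tip (n : ℕ) (q : ℕ → ℝ) (τ : ℝ) (f g : ℕ → ℝ) : ℝ :=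
  ∑ k ∈ Finset.range (n + 1), q k * Real.exp (k * τ) * (f k * g k)

section tip

variable (n : ℕ) (q : ℕ → ℝ) (τ : ℝ)

lemma tip_comm (f g : ℕ → ℝ) : tip n q τ f g = tip n q τ g f := by
  simp only [tip, mul_comm (f _)]

lemma tip_add (f g h : ℕ → ℝ) : tip n q τ f (g + h) = tip n q τ f g + tip n q τ f h := by
  simp only [tip, ← Finset.sum_add_distrib, Pi.add_apply]
  exact Finset.sum_congr rfl fun k _ => by ring

lemma tip_smul (c : ℝ) (f g : ℕ → ℝ) : tip n q τ f (c • g) = c * tip n q τ f g := by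
  simp only [tip, Finset.mul_sum, Pi.smul_apply, smul_eq_mul]
  exact Finset.sum_congr rfl fun k _ => by ring

lemma tip_zero (f : ℕ → ℝ) : tip n q τ f 0 = 0 := by
  simp [tip]

lemma zero_tip (f : ℕ → ℝ) : tip n q τ 0 f = 0 := by
  simp [tip]

lemma tip_mul_left (e f g : ℕ → ℝ) : tip n q τ (e * f) g = tip n q τ f (e * g) := by
  simp only [tip, Pi.mul_apply]
  exact Finset.sum_congr rfl fun k _ => by ring

end tip

/-- The identity function `k ↦ k`, as a real sequence. -/
def idx : ℕ → ℝ := fun k => k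

/-- The third term comes from the weight: differentiating `exp (k τ)` brings down `k`. -/
lemma hasDerivAt_tip (n : ℕ) (q : ℕ → ℝ) {τ : ℝ} {f g : ℝ → ℕ → ℝ} {f' g' : ℕ → ℝ}
    (hf : ∀ k, HasDerivAt (fun s => f s k) (f' k) τ)
    (hg : ∀ k, HasDerivAt (fun s => g s k) (g' k) τ) :
    HasDerivAt (fun s => tip n q s (f s) (g s))
      (tip n q τ f' (g τ) + tip n q τ (f τ) g' + tip n q τ (idx * f τ) (g τ)) τ := by
  simp only [tip, ← Finset.sum_add_distrib]
  refine HasDerivAt.fun_sum fun k _ => ?_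
  have h1 : HasDerivAt (fun s : ℝ => q k * Real.exp (k * s)) (q k * (Real.exp (k * τ) * k)) τ := by
    have := ((hasDerivAt_id τ).const_mul (k : ℝ)).exp.const_mul (q k)
    simpa using this
  refine (h1.mul ((hf k).mul (hg k))).congr_deriv ?_
  simp only [idx, Pi.mul_apply]
  ring

/-- The orthogonal polynomials of the tilted weights, restricted to the nonnegative integers and
shifted by one: the sequence starts `0, 1, …`, and `orth n q τ (j + 1)` has degree `j`. -/
def orth (n : ℕ) (q : ℕ → ℝ) (τ : ℝ) : ℕ → ℕ → ℝ
  | 0 => 0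
  | 1 => 1
  | j + 2 =>
    idx * orth n q τ (j + 1)
      + (-(tip n q τ (orth n q τ (j + 1)) (idx * orth n q τ (j + 1)) /
        tip n q τ (orth n q τ (j + 1)) (orth n q τ (j + 1)))) • orth n q τ (j + 1)
      + (-(tip n q τ (orth n q τ (j + 1)) (orth n q τ (j + 1)) /
        tip n q τ (orth n q τ j) (orth n q τ j))) • orth n q τ j

/-- Squared norms of the orthogonal polynomials. -/
def onorm (n : ℕ) (q : ℕ → ℝ) (τ : ℝ) (j : ℕ) : ℝ := tip n q τ (orth n q τ j) (orth n q τ j)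

/-- Diagonal recurrence coefficients. -/
def diagCoeff (n : ℕ) (q : ℕ → ℝ) (τ : ℝ) (j : ℕ) : ℝ :=
  tip n q τ (orth n q τ j) (idx * orth n q τ j) / onorm n q τ j

/-- Off-diagonal recurrence coefficients. -/
def offCoeff (n : ℕ) (q : ℕ → ℝ) (τ : ℝ) (j : ℕ) : ℝ := onorm n q τ (j + 1) / onorm n q τ j

section orth

variable {n : ℕ} {q : ℕ → ℝ}

lemma orth_add_two (τ : ℝ) (j : ℕ) :
    orth n q τ (j + 2) = idx * orth n q τ (j + 1)
      + (-diagCoeff n q τ (j + 1)) • orth n q τ (j + 1) + (-offCoeff n q τ j) • orth n q τ j := by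
  simp only [orth, diagCoeff, offCoeff, onorm]

lemma idx_mul_orth (τ : ℝ) (j : ℕ) :
    idx * orth n q τ (j + 1) = orth n q τ (j + 2)
      + diagCoeff n q τ (j + 1) • orth n q τ (j + 1) + offCoeff n q τ j • orth n q τ j := by
  rw [orth_add_two]
  module

lemma onorm_zero (τ : ℝ) : onorm n q τ 0 = 0 := by
  simp [onorm, orth, tip]

/-- Division by zero is zero here, so the convention `orth 0 = 0` lets the recurrence and the Toda
equations hold at the first index without a separate case. -/
lemma offCoeff_zero (τ : ℝ) : offCoeff n q τ 0 = 0 := by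
  simp [offCoeff, onorm_zero]

lemma exists_poly_orth (τ : ℝ) (j : ℕ) :
    (∃ p : ℝ[X], p.Monic ∧ p.natDegree = j ∧ ∀ k : ℕ, orth n q τ (j + 1) k = p.eval (k : ℝ)) ∧
    ∃ p : ℝ[X], p.degree < j ∧ ∀ k : ℕ, orth n q τ j k = p.eval (k : ℝ) := by
  induction j with
  | zero =>
    exact ⟨⟨1, monic_one, natDegree_one, by simp [orth]⟩, ⟨0, by simp, by simp [orth]⟩⟩
  | succ j ih =>
    obtain ⟨⟨p, hp, hpd, hpe⟩, ⟨p', hd', he'⟩⟩ := ih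
    have hpdeg : p.degree = j := by rw [degree_eq_natDegree hp.ne_zero, hpd]
    refine ⟨?_, p, by rw [hpdeg]; exact_mod_cast Nat.lt_succ_self j, hpe⟩
    have hm : ((X - C (diagCoeff n q τ (j + 1))) * p).Monic := (monic_X_sub_C _).mul hp
    have hmd : ((X - C (diagCoeff n q τ (j + 1))) * p).degree = ((j + 1 : ℕ) : WithBot ℕ) := by
      rw [degree_mul, degree_X_sub_C, hpdeg, add_comm]; rfl
    have hlt : (C (offCoeff n q τ j) * p').degree <
        ((X - C (diagCoeff n q τ (j + 1))) * p).degree := by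
      rw [hmd]
      have hle : (C (offCoeff n q τ j) * p').degree ≤ p'.degree := by
        rw [← smul_eq_C_mul]; exact degree_smul_le _ _
      refine hle.trans_lt (hd'.trans ?_)
      exact_mod_cast Nat.lt_succ_self j
    refine ⟨(X - C (diagCoeff n q τ (j + 1))) * p - C (offCoeff n q τ j) * p',
      hm.sub_of_left hlt, ?_, ?_⟩
    · apply natDegree_eq_of_degree_eq_some
      rw [degree_sub_eq_left_of_degree_lt hlt, hmd]
    · intro k
      rw [orth_add_two]
      simp only [Pi.add_apply, Pi.mul_apply, Pi.smul_apply, smul_eq_mul, idx, hpe, he', eval_sub,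
        eval_mul, eval_X, eval_C]
      ring

/-- A monic polynomial of degree `j ≤ n` cannot vanish at all the `n + 1` nodes `0, …, n`. -/
lemma onorm_pos (hq : ∀ k ≤ n, 0 < q k) (τ : ℝ) {j : ℕ} (hj : j ≤ n) :
    0 < onorm n q τ (j + 1) := by
  obtain ⟨⟨p, hp, hpd, hpe⟩, -⟩ := exists_poly_orth (n := n) (q := q) τ j
  have hw : ∀ k ∈ Finset.range (n + 1), 0 < q k * Real.exp (k * τ) := fun k hk =>
    mul_pos (hq k (by simpa [Nat.lt_succ_iff] using hk)) (Real.exp_pos _)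
  refine Finset.sum_pos' (fun k hk => mul_nonneg (hw k hk).le (mul_self_nonneg _)) ?_
  by_contra! hcon
  have hroot : ∀ k ∈ Finset.range (n + 1), p.eval (k : ℝ) = 0 := by
    intro k hk
    have := hcon k hk
    rw [hpe] at this
    have h2 := nonpos_of_mul_nonpos_right this (hw k hk)
    exact mul_self_eq_zero.1 (le_antisymm h2 (mul_self_nonneg _))
  refine hp.ne_zero (eq_zero_of_natDegree_lt_card_of_eval_eq_zero' p
    ((Finset.range (n + 1)).image fun k : ℕ => (k : ℝ)) ?_ ?_)
  · simpa using hroot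
  · rw [Finset.card_image_of_injective _ Nat.cast_injective, Finset.card_range]
    omega

lemma onorm_ne_zero (hq : ∀ k ≤ n, 0 < q k) (τ : ℝ) {j : ℕ} (hj : j ≤ n) :
    onorm n q τ (j + 1) ≠ 0 := (onorm_pos hq τ hj).ne'

/-- Multiplication by `idx` is self-adjoint, so it can be moved to the lower polynomial and expanded
by the recurrence. The coefficients of the recurrence are chosen to cancel the two products that do
not vanish by induction. -/
lemma tip_orth_eq_zero (hq : ∀ k ≤ n, 0 < q k) (τ : ℝ) {j : ℕ} (hj : j ≤ n + 1) :
    ∀ i < j, tip n q τ (orth n q τ i) (orth n q τ j) = 0 := by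
  induction j using Nat.strong_induction_on with
  | _ j ih =>
  intro i hi
  match j, ih, hi, hj with
  | 1, _, hi, _ =>
    obtain rfl : i = 0 := by omega
    exact zero_tip _ _ _ _
  | m + 2, ih, hi, hj =>
    rcases Nat.eq_zero_or_pos i with rfl | hi0
    · exact zero_tip _ _ _ _
    obtain ⟨l, rfl⟩ := Nat.exists_eq_succ_of_ne_zero hi0.ne'
    rw [Nat.succ_eq_add_one] at *
    have hsm : tip n q τ (orth n q τ (m + 1)) (orth n q τ m) = 0 := by
      rw [tip_comm]; exact ih (m + 1) (by omega) (by omega) m (by omega)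
    rw [orth_add_two, tip_add, tip_add, tip_smul, tip_smul]
    rcases Nat.lt_or_ge l m with hlm | hlm
    · have h1 : tip n q τ (orth n q τ (l + 1)) (orth n q τ (m + 1)) = 0 :=
        ih (m + 1) (by omega) (by omega) _ (by omega)
      rw [h1, ← tip_mul_left, idx_mul_orth, tip_comm, tip_add, tip_add, tip_smul, tip_smul,
        tip_comm _ _ _ _ (orth n q τ (l + 1)), h1, tip_comm _ _ _ _ (orth n q τ l),
        ih (m + 1) (by omega) (by omega) l (by omega)]
      rcases Nat.lt_or_ge (l + 1) m with hlm' | hlm'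
      · rw [tip_comm, ih (m + 1) (by omega) (by omega) _ (by omega),
          ih m (by omega) (by omega) _ hlm']
        ring
      · obtain rfl : m = l + 1 := by omega
        change onorm n q τ (l + 2) + _ + _ + _ + _ * onorm n q τ (l + 1) = 0
        have hb : offCoeff n q τ (l + 1) = onorm n q τ (l + 2) / onorm n q τ (l + 1) := rfl
        have := onorm_ne_zero hq τ (j := l) (by omega)
        rw [hb]
        field_simp
        ring
    · obtain rfl : l = m := by omega
      rw [hsm]
      change _ + _ * onorm n q τ (l + 1) + _ = 0
      rw [diagCoeff]
      have := onorm_ne_zero hq τ (j := l) (by omega)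
      field_simp
      ring

lemma tip_orth_eq_zero' (hq : ∀ k ≤ n, 0 < q k) (τ : ℝ) {i j : ℕ} (hj : j ≤ n + 1) (hi : i < j) :
    tip n q τ (orth n q τ j) (orth n q τ i) = 0 := by
  rw [tip_comm]; exact tip_orth_eq_zero hq τ hj i hi

/-- The second argument is polynomial of degree `i + l - 1` (zero if `l = 0`), and `orth j` has
degree `j - 1`: lower degrees are orthogonal to it, and at equal degree only the monic top term
counts. -/
lemma tip_orth_pow_mul (hq : ∀ k ≤ n, 0 < q k) (τ : ℝ) {j : ℕ} (hj : j ≤ n + 1) (i l : ℕ) :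
    (i + l < j → tip n q τ (orth n q τ j) (idx ^ i * orth n q τ l) = 0) ∧
    (i + (l + 1) = j → tip n q τ (orth n q τ j) (idx ^ i * orth n q τ (l + 1)) = onorm n q τ j) := by
  induction i generalizing l with
  | zero =>
    refine ⟨fun h => ?_, fun h => ?_⟩
    · rw [pow_zero, one_mul]; exact tip_orth_eq_zero' hq τ hj (by omega)
    · obtain rfl : l + 1 = j := by omega
      rw [pow_zero, one_mul]; rfl
  | succ i ih =>
    have key : ∀ l, tip n q τ (orth n q τ j) (idx ^ (i + 1) * orth n q τ (l + 1)) =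
        tip n q τ (orth n q τ j) (idx ^ i * orth n q τ (l + 2)) +
        diagCoeff n q τ (l + 1) * tip n q τ (orth n q τ j) (idx ^ i * orth n q τ (l + 1)) +
        offCoeff n q τ l * tip n q τ (orth n q τ j) (idx ^ i * orth n q τ l) := by
      intro l
      rw [pow_succ, mul_assoc, idx_mul_orth, mul_add, mul_add, tip_add, tip_add,
        mul_smul_comm, mul_smul_comm, tip_smul, tip_smul]
    refine ⟨fun h => ?_, fun h => ?_⟩
    · rcases l with _ | l
      · change tip n q τ (orth n q τ j) (idx ^ (i + 1) * 0) = 0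
        rw [mul_zero, tip_zero]
      · rw [key, (ih (l + 2)).1 (by omega), (ih (l + 1)).1 (by omega), (ih l).1 (by omega)]
        ring
    · rw [key, (ih (l + 1)).2 (by omega), (ih (l + 1)).1 (by omega), (ih l).1 (by omega)]
      ring

/-- The derivative of `orth n q τ j` with respect to `τ`. -/
def orthDeriv (n : ℕ) (q : ℕ → ℝ) (τ : ℝ) : ℕ → ℕ → ℝ
  | 0 => 0
  | j + 1 => (-offCoeff n q τ j) • orth n q τ j

/-- The common factor cannot be cancelled: at `j = 0` it vanishes while `onorm 0 = 0` and `onorm 1 ≠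
0`. -/
lemma offCoeff_mul_onorm (hq : ∀ k ≤ n, 0 < q k) (τ : ℝ) {j : ℕ} (hj : j ≤ n) :
    offCoeff n q τ j * (offCoeff n q τ j * onorm n q τ j) =
      offCoeff n q τ j * onorm n q τ (j + 1) := by
  rcases j with _ | j
  · simp [offCoeff_zero]
  · have := onorm_ne_zero hq τ (j := j) (by omega)
    rw [offCoeff]
    field_simp

/-- The derivative of a monic orthogonal polynomial has lower degree, hence is orthogonal to it, and
only the derivative of the weight survives. -/
lemma hasDerivAt_onorm (hq : ∀ k ≤ n, 0 < q k) {τ : ℝ} {j : ℕ} (hj : j ≤ n)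
    (hd : ∀ k, HasDerivAt (fun s => orth n q s (j + 1) k) (orthDeriv n q τ (j + 1) k) τ) :
    HasDerivAt (fun s => onorm n q s (j + 1))
      (diagCoeff n q τ (j + 1) * onorm n q τ (j + 1)) τ := by
  refine (hasDerivAt_tip n q hd hd).congr_deriv ?_
  have := onorm_ne_zero hq τ hj
  rw [tip_comm _ _ _ (orthDeriv n q τ (j + 1)), orthDeriv, tip_smul,
    tip_orth_eq_zero' hq τ (by omega) (Nat.lt_succ_self j), diagCoeff, tip_comm]
  field_simp
  ring

lemma hasDerivAt_diagCoeff (hq : ∀ k ≤ n, 0 < q k) {τ : ℝ} {j : ℕ} (hj : j + 1 ≤ n)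
    (hd : ∀ k, HasDerivAt (fun s => orth n q s (j + 1) k) (orthDeriv n q τ (j + 1) k) τ) :
    HasDerivAt (fun s => diagCoeff n q s (j + 1))
      (offCoeff n q τ (j + 1) - offCoeff n q τ j) τ := by
  have h0 := onorm_ne_zero hq τ (j := j) (by omega)
  have hd' : ∀ k, HasDerivAt (fun s => (idx * orth n q s (j + 1)) k)
      ((idx * orthDeriv n q τ (j + 1)) k) τ := fun k => (hd k).const_mul (idx k)
  refine ((hasDerivAt_tip n q hd hd').div (hasDerivAt_onorm hq (by omega) hd) h0).congr_deriv ?_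
  have e1 : offCoeff n q τ j * tip n q τ (orth n q τ j) (idx * orth n q τ (j + 1)) =
      offCoeff n q τ j * onorm n q τ (j + 1) := by
    rcases j with _ | j
    · simp [offCoeff_zero]
    · rw [← tip_mul_left, tip_comm, idx_mul_orth, tip_add, tip_add, tip_smul, tip_smul,
        tip_orth_eq_zero' hq τ (by omega) (Nat.lt_succ_self _),
        tip_orth_eq_zero' hq τ (by omega) (by omega : j < j + 2), onorm]
      ring
  have e2 : tip n q τ (idx * orth n q τ (j + 1)) (idx * orth n q τ (j + 1)) =
      onorm n q τ (j + 2) + diagCoeff n q τ (j + 1) ^ 2 * onorm n q τ (j + 1)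
        + offCoeff n q τ j * onorm n q τ (j + 1) := by
    rw [← offCoeff_mul_onorm hq τ (by omega)]
    rw [idx_mul_orth, tip_add, tip_add, tip_smul, tip_smul]
    rw [tip_comm _ _ _ _ (orth n q τ (j + 2)), tip_comm _ _ _ _ (orth n q τ (j + 1)),
      tip_comm _ _ _ _ (orth n q τ j)]
    simp only [tip_add, tip_smul]
    rw [tip_orth_eq_zero' hq τ (by omega) (by omega : j + 1 < j + 2),
      tip_orth_eq_zero' hq τ (by omega) (by omega : j < j + 2),
      tip_orth_eq_zero' hq τ (by omega) (by omega : j < j + 1),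
      tip_orth_eq_zero hq τ (by omega) _ (by omega : j + 1 < j + 2),
      tip_orth_eq_zero hq τ (by omega) _ (by omega : j < j + 2),
      tip_orth_eq_zero hq τ (by omega) _ (by omega : j < j + 1)]
    simp only [onorm]
    ring
  have e3 : tip n q τ (orthDeriv n q τ (j + 1)) (idx * orth n q τ (j + 1)) =
      -(offCoeff n q τ j * onorm n q τ (j + 1)) := by
    rw [orthDeriv, tip_comm, tip_smul, tip_comm, neg_mul, e1]
  have e4 : tip n q τ (orth n q τ (j + 1)) (idx * orthDeriv n q τ (j + 1)) =
      -(offCoeff n q τ j * onorm n q τ (j + 1)) := by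
    rw [← tip_mul_left, tip_comm, e3]
  have e5 : tip n q τ (orth n q τ (j + 1)) (idx * orth n q τ (j + 1)) =
      diagCoeff n q τ (j + 1) * onorm n q τ (j + 1) := by
    rw [diagCoeff]; field_simp
  have hb : offCoeff n q τ (j + 1) = onorm n q τ (j + 2) / onorm n q τ (j + 1) := rfl
  rw [e3, e4, e2, e5, hb]
  field_simp
  ring

/-- Differentiate the three-term recurrence; inserting the Toda equations for its coefficients, the
result collapses by the recurrence one index lower. -/
lemma hasDerivAt_orth (hq : ∀ k ≤ n, 0 < q k) (τ : ℝ) {j : ℕ} (hj : j ≤ n + 1) (k : ℕ) :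
    HasDerivAt (fun s => orth n q s j k) (orthDeriv n q τ j k) τ := by
  induction j using Nat.strong_induction_on generalizing k with
  | _ j ih =>
  match j, ih, hj with
  | 0, _, _ => exact hasDerivAt_const τ (0 : ℝ)
  | 1, _, _ =>
    refine (hasDerivAt_const τ (1 : ℝ)).congr_deriv ?_
    simp [orthDeriv, orth]
  | m + 2, ih, hj =>
    have d1 : ∀ k, HasDerivAt (fun s => orth n q s (m + 1) k) (orthDeriv n q τ (m + 1) k) τ :=
      ih (m + 1) (by omega) (by omega)
    have d0 : ∀ k, HasDerivAt (fun s => orth n q s m k) (orthDeriv n q τ m k) τ :=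
      ih m (by omega) (by omega)
    have da := hasDerivAt_diagCoeff hq (by omega) d1
    have db : HasDerivAt (fun s => offCoeff n q s m)
        (offCoeff n q τ m * (diagCoeff n q τ (m + 1) - diagCoeff n q τ m)) τ := by
      rcases m with _ | m
      · simp only [offCoeff_zero, zero_mul]
        exact hasDerivAt_const τ (0 : ℝ)
      · have h0 := onorm_ne_zero hq τ (j := m) (by omega)
        refine ((hasDerivAt_onorm hq (by omega) d1).div
          (hasDerivAt_onorm hq (by omega) d0) h0).congr_deriv ?_
        rw [offCoeff]
        field_simp
    have hfun : (fun s => orth n q s (m + 2) k) = fun s => idx k * orth n q s (m + 1) k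
        - diagCoeff n q s (m + 1) * orth n q s (m + 1) k - offCoeff n q s m * orth n q s m k := by
      funext s
      rw [orth_add_two]
      simp only [Pi.add_apply, Pi.mul_apply, Pi.smul_apply, smul_eq_mul]
      ring
    rw [hfun]
    refine ((((d1 k).const_mul (idx k)).sub (da.mul (d1 k))).sub (db.mul (d0 k))).congr_deriv ?_
    rcases m with _ | m
    · simp [orthDeriv, orth, offCoeff_zero]
    · simp only [orthDeriv, Pi.smul_apply, smul_eq_mul]
      have := congrFun (idx_mul_orth (n := n) (q := q) τ m) k
      simp only [Pi.add_apply, Pi.mul_apply, Pi.smul_apply, smul_eq_mul] at this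
      linear_combination (-offCoeff n q τ (m + 1)) * this

/-- The Fourier coefficients of `a` with respect to the orthogonal polynomials. -/
def fourierCoeff (n : ℕ) (q : ℕ → ℝ) (a : ℕ → ℝ) (j : ℕ) (τ : ℝ) : ℝ :=
  tip n q τ (orth n q τ (j + 1)) a / onorm n q τ (j + 1)

/-- Expand `idx * orth (j + 1)` by the recurrence: its diagonal term cancels against the derivative
of the norm, its lower term against the derivative of `orth (j + 1)`. Only the next coefficient
remains. -/
lemma hasDerivAt_fourierCoeff (hq : ∀ k ≤ n, 0 < q k) (a : ℕ → ℝ) (τ : ℝ) {j : ℕ} (hj : j + 1 ≤ n) :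
    HasDerivAt (fourierCoeff n q a j)
      (offCoeff n q τ (j + 1) * fourierCoeff n q a (j + 1) τ) τ := by
  have h0 := onorm_ne_zero hq τ (j := j) (by omega)
  have h1 := onorm_ne_zero hq τ hj
  have d := hasDerivAt_orth hq τ (j := j + 1) (by omega)
  refine ((hasDerivAt_tip n q d fun k => hasDerivAt_const τ (a k)).div
    (hasDerivAt_onorm hq (by omega) d) h0).congr_deriv ?_
  have e0 : tip n q τ (orth n q τ (j + 1)) (fun _ => 0) = 0 := tip_zero n q τ _
  have e1 : tip n q τ (idx * orth n q τ (j + 1)) a = tip n q τ (orth n q τ (j + 2)) a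
      + diagCoeff n q τ (j + 1) * tip n q τ (orth n q τ (j + 1)) a
      + offCoeff n q τ j * tip n q τ (orth n q τ j) a := by
    rw [idx_mul_orth, tip_comm, tip_add, tip_add, tip_smul, tip_smul]
    simp only [tip_comm n q τ a]
  have e2 : tip n q τ (orthDeriv n q τ (j + 1)) a =
      -(offCoeff n q τ j * tip n q τ (orth n q τ j) a) := by
    rw [orthDeriv, tip_comm, tip_smul, tip_comm, neg_mul]
  have hb : offCoeff n q τ (j + 1) = onorm n q τ (j + 2) / onorm n q τ (j + 1) := rfl
  rw [e0, e1, e2, hb, fourierCoeff]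
  field_simp
  ring

lemma offCoeff_pos (hq : ∀ k ≤ n, 0 < q k) (τ : ℝ) {j : ℕ} (hj : j + 1 ≤ n) :
    0 < offCoeff n q τ (j + 1) :=
  div_pos (onorm_pos hq τ hj) (onorm_pos hq τ (by omega))

lemma fourierCoeff_natDegree (hq : ∀ k ≤ n, 0 < q k) (τ : ℝ) (p : ℝ[X]) (hp : p.natDegree ≤ n) :
    fourierCoeff n q (fun k => p.eval (k : ℝ)) p.natDegree τ = p.leadingCoeff := by
  have h0 := onorm_ne_zero hq τ hp
  have hsum : (fun k : ℕ => p.eval (k : ℝ)) =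
      ∑ i ∈ Finset.range (p.natDegree + 1), p.coeff i • (idx ^ i * orth n q τ (0 + 1)) := by
    funext k
    rw [eval_eq_sum_range, Finset.sum_apply]
    refine Finset.sum_congr rfl fun i _ => ?_
    simp [idx, orth]
  have htip : ∀ (s : Finset ℕ) (F : ℕ → ℕ → ℝ) (f : ℕ → ℝ),
      tip n q τ f (∑ i ∈ s, F i) = ∑ i ∈ s, tip n q τ f (F i) := by
    intro s F f
    induction s using Finset.cons_induction with
    | empty => simp [tip_zero]
    | cons i s hi ih => rw [Finset.sum_cons, tip_add, ih, Finset.sum_cons]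
  rw [fourierCoeff, hsum, htip, Finset.sum_range_succ, Finset.sum_eq_zero, zero_add, tip_smul,
    (tip_orth_pow_mul hq τ (by omega) p.natDegree 0).2 (by omega), leadingCoeff]
  · field_simp
  · intro i hi
    rw [Finset.mem_range] at hi
    rw [tip_smul, (tip_orth_pow_mul hq τ (by omega) i (0 + 1)).1 (by omega), mul_zero]

end orth

/-! ### Counting zeros of the derivative of a tilted mean. -/

lemma exists_strictMono_zeros_of_deriv {m : ℕ} {F F' : ℝ → ℝ} (hF : ∀ x, HasDerivAt F (F' x) x)
    {t : Fin (m + 1) → ℝ} (ht : StrictMono t) (h0 : ∀ i, F (t i) = 0) :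
    ∃ s : Fin m → ℝ, StrictMono s ∧ ∀ i, F' (s i) = 0 := by
  have hc : ∀ i : Fin m, ∃ c ∈ Ioo (t i.castSucc) (t i.succ), F' c = 0 := fun i =>
    exists_hasDerivAt_eq_zero (ht i.castSucc_lt_succ)
      (fun x _ => (hF x).continuousAt.continuousWithinAt) (by rw [h0, h0]) (fun x _ => hF x)
  choose s hs hs0 using hc
  refine ⟨s, fun i j hij => ?_, hs0⟩
  refine (hs i).2.trans_le (le_trans (ht.monotone ?_) (hs j).1.le)
  rw [Fin.le_def]
  simpa using hij

/-- The mean of `a` under the tilted weights, as a function of the tilt. If its derivative has `n`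
zeros, then `a` is constant on `{0, …, n}`. -/
theorem const_of_deriv_mean_zeros {n : ℕ} {q : ℕ → ℝ} (hq : ∀ k ≤ n, 0 < q k) (a : ℕ → ℝ)
    {t : Fin n → ℝ} (ht : StrictMono t)
    (h0 : ∀ i, deriv (fun τ => (∑ k ∈ Finset.range (n + 1), q k * Real.exp (k * τ) * a k) /
      ∑ k ∈ Finset.range (n + 1), q k * Real.exp (k * τ)) (t i) = 0) :
    ∀ k ≤ n, a k = a 0 := by
  -- Only the values of `a` at `0, …, n` enter, so `a` may be replaced by its interpolating
  -- polynomial, whose degree tells where the Fourier coefficients end.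
  obtain ⟨p, hpd, hpe⟩ : ∃ p : ℝ[X], p.natDegree ≤ n ∧ ∀ k ≤ n, p.eval (k : ℝ) = a k := by
    have hinj : Set.InjOn (fun k : ℕ => (k : ℝ)) (Finset.range (n + 1)) :=
      Nat.cast_injective.injOn
    refine ⟨Lagrange.interpolate (Finset.range (n + 1)) (fun k => (k : ℝ)) a, ?_, fun k hk =>
      Lagrange.eval_interpolate_at_node a hinj (by simpa [Nat.lt_succ_iff] using hk)⟩
    have := Lagrange.degree_interpolate_lt a hinj
    rw [Finset.card_range] at this
    exact natDegree_le_iff_coeff_eq_zero.2 fun N hN =>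
      coeff_eq_zero_of_degree_lt (this.trans_le (by exact_mod_cast hN))
  have hB0 : (fun τ => (∑ k ∈ Finset.range (n + 1), q k * Real.exp (k * τ) * a k) /
      ∑ k ∈ Finset.range (n + 1), q k * Real.exp (k * τ)) =
      fourierCoeff n q (fun k => p.eval (k : ℝ)) 0 := by
    funext τ
    simp only [fourierCoeff, onorm, tip, orth, Pi.one_apply, one_mul, mul_one]
    congr 1
    refine Finset.sum_congr rfl fun k hk => ?_
    rw [hpe k (by simpa [Nat.lt_succ_iff] using hk)]
  by_cases hd : p.natDegree = 0
  · obtain ⟨c, hc⟩ := natDegree_eq_zero.1 hd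
    intro k hk
    rw [← hpe k hk, ← hpe 0 (Nat.zero_le n), ← hc, eval_C, eval_C]
  · exfalso
    rw [hB0] at h0
    -- The coefficient of index `j + 1` has `n - j` zeros: each Rolle step loses one.
    have key : ∀ j m, j + 1 ≤ n → j + m = n → ∃ s : Fin m → ℝ, StrictMono s ∧
        ∀ i, fourierCoeff n q (fun k => p.eval (k : ℝ)) (j + 1) (s i) = 0 := by
      intro j
      induction j with
      | zero =>
        intro m hj hm
        obtain rfl : m = n := by omega
        refine ⟨t, ht, fun i => ?_⟩
        have := h0 i
        rw [(hasDerivAt_fourierCoeff hq _ (t i) hj).deriv] at this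
        exact (mul_eq_zero.1 this).resolve_left (offCoeff_pos hq _ hj).ne'
      | succ j ih =>
        intro m hj hm
        obtain ⟨s, hs, hs0⟩ := ih (m + 1) (by omega) (by omega)
        obtain ⟨s', hs', hs0'⟩ := exists_strictMono_zeros_of_deriv
          (fun τ => hasDerivAt_fourierCoeff hq _ τ hj) hs hs0
        exact ⟨s', hs', fun i =>
          (mul_eq_zero.1 (hs0' i)).resolve_left (offCoeff_pos hq _ hj).ne'⟩
    -- With `deg p = d + 1 ≤ n`, at least one zero is left for the constant coefficient of index `d
    -- + 1`.
    obtain ⟨d, hd'⟩ := Nat.exists_eq_succ_of_ne_zero hd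
    obtain ⟨s, -, hs0⟩ := key d (n - d) (by omega) (by omega)
    have h1 := hs0 ⟨0, by omega⟩
    rw [← Nat.succ_eq_add_one, ← hd', fourierCoeff_natDegree hq _ p hpd] at h1
    rw [leadingCoeff_eq_zero.1 h1] at hd
    exact hd natDegree_zero

/-! ### Passage to positive coefficients by a Möbius map, and the Haar property. -/

/-- Up to a constant, `q` is `(r - x) ^ n * Q ((r + x) / (r - x))` for a polynomial `Q` of degree
`n` all of whose coefficients are positive. -/
def HasPosForm (r : ℝ) (n : ℕ) (q : ℝ[X]) : Prop :=
  ∃ s : ℝ, s ≠ 0 ∧ ∃ Q : ℝ[X], Q.natDegree ≤ n ∧ (∀ k ≤ n, 0 < Q.coeff k) ∧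
    ∀ x, x ≠ r → s * q.eval x = (r - x) ^ n * Q.eval ((r + x) / (r - x))

lemma HasPosForm.mul {r : ℝ} {m n : ℕ} {p q : ℝ[X]} (hp : HasPosForm r m p)
    (hq : HasPosForm r n q) : HasPosForm r (m + n) (p * q) := by
  obtain ⟨s, hs, P, hPd, hPc, hP⟩ := hp
  obtain ⟨s', hs', Q, hQd, hQc, hQ⟩ := hq
  refine ⟨s * s', mul_ne_zero hs hs', P * Q, natDegree_mul_le.trans (add_le_add hPd hQd), ?_, ?_⟩
  · have h0 : ∀ {R : ℝ[X]} {l : ℕ}, R.natDegree ≤ l → (∀ k ≤ l, 0 < R.coeff k) →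
        ∀ k, 0 ≤ R.coeff k := by
      intro R l hd hc k
      rcases le_or_gt k l with h | h
      · exact (hc k h).le
      · rw [coeff_eq_zero_of_natDegree_lt (hd.trans_lt h)]
    intro k hk
    rw [coeff_mul]
    refine Finset.sum_pos' (fun i _ => mul_nonneg (h0 hPd hPc _) (h0 hQd hQc _)) ?_
    refine ⟨(min k m, k - min k m), ?_, ?_⟩
    · rw [Finset.HasAntidiagonal.mem_antidiagonal]; omega
    · exact mul_pos (hPc _ (by omega)) (hQc _ (by omega))
  · intro x hx
    rw [eval_mul, eval_mul, mul_mul_mul_comm, hP x hx, hQ x hx, pow_add]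
    ring

/-- In the new variable `u`, the factor becomes `(r - a) u - (r + a)` up to scaling; the two
coefficients have the same sign exactly because `|a| > r`. -/
lemma hasPosForm_linear {r a : ℝ} (hr : 0 < r) (ha : r < |a|) :
    HasPosForm r 1 (X - C a) := by
  obtain ⟨s, hs, h1, h2⟩ : ∃ s : ℝ, s ≠ 0 ∧ 0 < s * (r - a) ∧ 0 < s * (-(r + a)) := by
    rcases lt_abs.1 ha with h | h
    · exact ⟨-1, by norm_num, by linarith, by linarith⟩
    · exact ⟨1, by norm_num, by linarith, by linarith⟩
  refine ⟨2 * r * s, by positivity, C (s * (r - a)) * X + C (s * (-(r + a))),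
    natDegree_linear_le, ?_, ?_⟩
  · intro k hk
    interval_cases k
    · simpa using h2
    · simpa using h1
  · intro x hx
    have : r - x ≠ 0 := sub_ne_zero.2 hx.symm
    simp only [eval_sub, eval_add, eval_mul, eval_X, eval_C]
    field_simp
    ring

/-- The outer coefficients are squared distances of the zero to `±r`; the middle one is positive
exactly because the zero lies outside the disc of radius `r`. -/
lemma hasPosForm_quadratic {r α γ : ℝ} (hr : 0 < r) (h : r ^ 2 < α ^ 2 + γ ^ 2) (hγ : γ ≠ 0) :
    HasPosForm r 2 (X ^ 2 + C (-2 * α) * X + C (α ^ 2 + γ ^ 2)) := by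
  have hγ2 : 0 < γ ^ 2 := by positivity
  have hc : ∀ A B D : ℝ, (C A * X ^ 2 + C B * X + C D).coeff 0 = D ∧
      (C A * X ^ 2 + C B * X + C D).coeff 1 = B ∧ (C A * X ^ 2 + C B * X + C D).coeff 2 = A :=
    fun A B D => ⟨by simp, by simp [coeff_X_pow, coeff_C], by simp⟩
  refine ⟨4 * r ^ 2, by positivity, C ((r - α) ^ 2 + γ ^ 2) * X ^ 2 +
    C (2 * (α ^ 2 + γ ^ 2 - r ^ 2)) * X + C ((r + α) ^ 2 + γ ^ 2), natDegree_quadratic_le, ?_, ?_⟩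
  · intro k hk
    interval_cases k
    · rw [(hc _ _ _).1]; positivity
    · rw [(hc _ _ _).2.1]; linarith
    · rw [(hc _ _ _).2.2]; positivity
  · intro x hx
    have : r - x ≠ 0 := sub_ne_zero.2 hx.symm
    simp only [eval_add, eval_mul, eval_X, eval_C, eval_pow]
    field_simp
    ring

lemma hasPosForm_of_roots {r : ℝ} (hr : 0 < r) (n : ℕ) : ∀ q : ℝ[X], IsMonicOfDegree q n →
    (∀ a : ℂ, aeval a q = 0 → r < ‖a‖) → HasPosForm r n q := by
  have hreal : ∀ {q : ℝ[X]}, (∀ a : ℂ, aeval a q = 0 → r < ‖a‖) → ∀ x : ℝ, q.eval x = 0 →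
      r < |x| := by
    intro q h x hx
    have := h x (by
      have := aeval_algebraMap_apply_eq_algebraMap_eval (A := ℂ) x q
      rw [hx, map_zero] at this
      exact this)
    simpa using this
  induction n using Nat.strong_induction_on with
  | _ n ih =>
  intro q hq hroot
  rcases n with _ | n
  · rw [isMonicOfDegree_zero_iff] at hq
    subst hq
    exact ⟨1, one_ne_zero, 1, by simp, by simp, by simp⟩
  · obtain ⟨f, g, hf, rfl⟩ := hq.eq_isMonicOfDegree_one_or_two_mul
    have hrf : ∀ a : ℂ, aeval a f = 0 → r < ‖a‖ := fun a ha =>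
      hroot a (by rw [map_mul, ha, zero_mul])
    have hrg : ∀ a : ℂ, aeval a g = 0 → r < ‖a‖ := fun a ha =>
      hroot a (by rw [map_mul, ha, mul_zero])
    rcases hf with hf | hf
    · have hg : IsMonicOfDegree g n := hf.of_mul_left (by rw [add_comm 1 n]; exact hq)
      rw [add_comm]
      refine HasPosForm.mul ?_ (ih n (by omega) g hg hrg)
      obtain ⟨c, rfl⟩ := isMonicOfDegree_one_iff.1 hf
      have := hasPosForm_linear hr (hreal hrf (-c) (by simp))
      simpa using this
    · have hn : 1 ≤ n := by
        have h1 := hq.natDegree_eq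
        have hg0 : g ≠ 0 := by rintro rfl; simpa using hq.ne_zero
        rw [natDegree_mul hf.ne_zero hg0, hf.natDegree_eq] at h1
        omega
      obtain ⟨m, rfl⟩ := Nat.exists_eq_add_of_le' hn
      have hg : IsMonicOfDegree g m := hf.of_mul_left (by rw [add_comm 2 m]; exact hq)
      rw [show m + 1 + 1 = 2 + m by omega]
      refine HasPosForm.mul ?_ (ih m (by omega) g hg hrg)
      obtain ⟨b, c, rfl⟩ := isMonicOfDegree_two_iff.1 hf
      -- The quadratic factor may still be reducible; then it is treated as two linear ones.
      by_cases hx : ∃ x : ℝ, x ^ 2 + b * x + c = 0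
      · obtain ⟨x, hx⟩ := hx
        have h1 := hasPosForm_linear hr (hreal hrf x (by simpa using hx))
        have h2 := hasPosForm_linear hr (hreal hrf (-b - x) (by
          simp only [eval_add, eval_pow, eval_X, eval_mul, eval_C]
          linear_combination hx))
        have := h1.mul h2
        convert this using 1
        have hc : c = x * (-b - x) := by linear_combination hx
        rw [hc]
        simp only [map_mul, map_sub, map_neg]
        ring
      · obtain ⟨a, ha⟩ := IsAlgClosed.exists_root
          ((X ^ 2 + C b * X + C c : ℝ[X]).map (algebraMap ℝ ℂ)) (by
            rw [degree_map, degree_eq_natDegree hf.ne_zero, hf.natDegree_eq]; norm_num)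
        have ha' : a ^ 2 + b * a + c = 0 := by
          simpa [IsRoot] using ha
        have hna := hrf a (by simpa using ha')
        have hre := congrArg Complex.re ha'
        have him := congrArg Complex.im ha'
        simp only [pow_two, Complex.add_re, Complex.mul_re, Complex.ofReal_re, Complex.ofReal_im,
          Complex.add_im, Complex.mul_im, Complex.zero_re, Complex.zero_im] at hre him
        have him0 : a.im ≠ 0 := by
          intro h0
          refine hx ⟨a.re, ?_⟩
          rw [h0] at hre
          linear_combination hre
        have hb : b = -2 * a.re := by
          have : a.im * (b + 2 * a.re) = 0 := by linear_combination him
          rcases mul_eq_zero.1 this with h | h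
          · exact absurd h him0
          · linarith
        have hc : c = a.re ^ 2 + a.im ^ 2 := by
          rw [hb] at hre
          linear_combination hre
        have hsq : r ^ 2 < a.re ^ 2 + a.im ^ 2 := by
          have h1 : r ^ 2 < ‖a‖ ^ 2 := by gcongr
          rw [Complex.sq_norm, Complex.normSq_apply] at h1
          linarith
        rw [hb, hc]
        exact hasPosForm_quadratic hr hsq him0

/-- With `u = (r + x)/(r - x)` one has `x/(r - x) = (u - 1)/2` and `1/(r - x) = (u + 1)/(2r)`; this
is homogenization in degree `n`. -/
lemma exists_mobius_form {r : ℝ} (hr : 0 < r) {n : ℕ} {p : ℝ[X]} (hp : p.natDegree ≤ n) :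
    ∃ P : ℝ[X], P.natDegree ≤ n ∧
      ∀ x, x ≠ r → p.eval x = (r - x) ^ n * P.eval ((r + x) / (r - x)) := by
  refine ⟨∑ k ∈ Finset.range (n + 1), C (p.coeff k) *
    ((C (1 / 2) * X + C (-1 / 2)) ^ k * (C (1 / (2 * r)) * X + C (1 / (2 * r))) ^ (n - k)), ?_, ?_⟩
  · refine natDegree_sum_le_of_forall_le _ _ fun k hk => ?_
    rw [Finset.mem_range] at hk
    refine (natDegree_C_mul_le _ _).trans (natDegree_mul_le.trans ?_)
    have h1 : ((C (1 / 2 : ℝ) * X + C (-1 / 2)) ^ k).natDegree ≤ k * 1 :=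
      natDegree_pow_le_of_le k natDegree_linear_le
    have h2 : ((C (1 / (2 * r)) * X + C (1 / (2 * r))) ^ (n - k)).natDegree ≤ (n - k) * 1 :=
      natDegree_pow_le_of_le (n - k) natDegree_linear_le
    omega
  · intro x hx
    have hx' : r - x ≠ 0 := sub_ne_zero.2 hx.symm
    rw [eval_eq_sum_range' (Nat.lt_succ_of_le hp), eval_finsetSum, Finset.mul_sum]
    refine Finset.sum_congr rfl fun k hk => ?_
    rw [Finset.mem_range] at hk
    simp only [eval_mul, eval_C, eval_pow, eval_add, eval_X]
    have e1 : (1 / 2 : ℝ) * ((r + x) / (r - x)) + -1 / 2 = x / (r - x) := by field_simp; ring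
    have e2 : 1 / (2 * r) * ((r + x) / (r - x)) + 1 / (2 * r) = 1 / (r - x) := by field_simp; ring
    rw [e1, e2, div_pow, div_pow, one_pow]
    have e3 : (r - x) ^ n = (r - x) ^ k * (r - x) ^ (n - k) := by
      rw [← pow_add]; congr 1; omega
    rw [e3]
    field_simp

/-- The room between `1` and the finitely many zeros keeps `[-1, 1]` inside `(-r, r)`, where the
change of variable is finite. -/
lemma exists_radius {q : ℝ[X]} (hq0 : q ≠ 0) (h : ∀ a : ℂ, aeval a q = 0 → 1 < ‖a‖) :
    ∃ r : ℝ, 1 < r ∧ ∀ a : ℂ, aeval a q = 0 → r < ‖a‖ := by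
  have key : ∀ s : Finset ℂ, (∀ a ∈ s, 1 < ‖a‖) → ∃ r : ℝ, 1 < r ∧ ∀ a ∈ s, r < ‖a‖ := by
    intro s
    induction s using Finset.cons_induction with
    | empty => exact fun _ => ⟨2, by norm_num, by simp⟩
    | cons b s hb ih =>
      intro hs
      obtain ⟨r, hr, hrs⟩ := ih fun a ha => hs a (by simp [ha])
      obtain ⟨r', hr', hrb⟩ := exists_between (hs b (by simp))
      refine ⟨min r r', lt_min hr hr', fun a ha => ?_⟩
      rcases Finset.mem_cons.1 ha with rfl | ha
      · exact (min_le_right _ _).trans_lt hrb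
      · exact (min_le_left _ _).trans_lt (hrs a ha)
  obtain ⟨r, hr, hrs⟩ := key (q.aroots ℂ).toFinset fun a ha =>
    h a ((mem_aroots.1 (Multiset.mem_toFinset.1 ha)).2)
  exact ⟨r, hr, fun a ha => hrs a (Multiset.mem_toFinset.2 (mem_aroots.2 ⟨hq0, ha⟩))⟩

lemma eval_ne_zero_of_roots {q : ℝ[X]} (h : ∀ a : ℂ, aeval a q = 0 → 1 < ‖a‖) {x : ℝ}
    (hx : x ∈ Icc (-1 : ℝ) 1) : q.eval x ≠ 0 := by
  intro h0
  have h1 := h x (by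
    have := aeval_algebraMap_apply_eq_algebraMap_eval (A := ℂ) x q
    rw [h0, map_zero] at this
    exact this)
  rw [Complex.norm_real, Real.norm_eq_abs] at h1
  exact absurd (abs_le.2 hx) (not_le.2 h1)

/-- If all zeros of `q` lie outside the closed unit disc, then the functions `(p / q)'` with
`deg p ≤ n = deg q` have the Haar property on `[-1, 1]`. -/
theorem wr_eq_zero_of_zeros {n : ℕ} {p q : ℝ[X]} (hq : IsMonicOfDegree q n)
    (hroot : ∀ a : ℂ, aeval a q = 0 → 1 < ‖a‖) (hp : p.natDegree ≤ n) {t : Fin n → ℝ}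
    (ht : StrictMono t) (htI : ∀ i, t i ∈ Icc (-1 : ℝ) 1) (h0 : ∀ i, (wr p q).eval (t i) = 0) :
    wr p q = 0 := by
  obtain ⟨r, hr1, hr⟩ := exists_radius hq.ne_zero hroot
  have hr0 : 0 < r := by linarith
  obtain ⟨s, hs, Q, hQd, hQc, hQ⟩ := hasPosForm_of_roots hr0 n q hq hr
  obtain ⟨P, hPd, hP⟩ := exists_mobius_form hr0 hp
  set a : ℕ → ℝ := fun k => P.coeff k / Q.coeff k with ha
  set A : ℝ → ℝ := fun τ =>
    (∑ k ∈ Finset.range (n + 1), Q.coeff k * Real.exp (k * τ) * a k) /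
      ∑ k ∈ Finset.range (n + 1), Q.coeff k * Real.exp (k * τ) with hA
  -- `T` is the substitution `τ = log ((r + x)/(r - x))`, increasing on `(-r, r)`; it carries zeros
  -- of `(p/q)'` to zeros of the derivative of the mean `A`.
  set T : ℝ → ℝ := fun x => Real.log (r + x) - Real.log (r - x) with hT
  have hden : ∀ τ : ℝ, 0 < ∑ k ∈ Finset.range (n + 1), Q.coeff k * Real.exp (k * τ) := fun τ =>
    Finset.sum_pos (fun k hk => mul_pos (hQc k (by simpa [Nat.lt_succ_iff] using hk))
      (Real.exp_pos _)) ⟨0, by simp⟩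
  have hQe : ∀ τ : ℝ, Q.eval (Real.exp τ) =
      ∑ k ∈ Finset.range (n + 1), Q.coeff k * Real.exp (k * τ) := by
    intro τ
    rw [eval_eq_sum_range' (Nat.lt_succ_of_le hQd)]
    refine Finset.sum_congr rfl fun k _ => ?_
    rw [← Real.exp_nat_mul]
  have hPe : ∀ τ : ℝ, P.eval (Real.exp τ) =
      ∑ k ∈ Finset.range (n + 1), Q.coeff k * Real.exp (k * τ) * a k := by
    intro τ
    rw [eval_eq_sum_range' (Nat.lt_succ_of_le hPd)]
    refine Finset.sum_congr rfl fun k hk => ?_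
    have := hQc k (by simpa [Nat.lt_succ_iff] using hk)
    rw [← Real.exp_nat_mul, ha]
    field_simp
  have hexpT : ∀ x, -r < x → x < r → Real.exp (T x) = (r + x) / (r - x) := by
    intro x h1 h2
    rw [hT]
    simp only
    rw [Real.exp_sub, Real.exp_log (by linarith), Real.exp_log (by linarith)]
  have hdT : ∀ x, -r < x → x < r → HasDerivAt T (1 / (r + x) + 1 / (r - x)) x := by
    intro x h1 h2
    have d1 := ((hasDerivAt_id x).const_add r).log (by simp only [id]; linarith)
    have d2 := ((hasDerivAt_id x).const_sub r).log (by simp only [id]; linarith)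
    refine (d1.sub d2).congr_deriv ?_
    simp only [id]
    ring
  have hTmono : ∀ x y, -r < x → x < y → y < r → T x < T y := by
    intro x y h1 h2 h3
    have e1 := Real.log_lt_log (by linarith : 0 < r + x) (by linarith : r + x < r + y)
    have e2 := Real.log_lt_log (by linarith : 0 < r - y) (by linarith : r - y < r - x)
    simp only [hT]
    linarith
  have hratio : ∀ x, -r < x → x < r → p.eval x / q.eval x = s * A (T x) := by
    intro x h1 h2
    have hx : r - x ≠ 0 := by linarith
    have hQx := hQ x h2.ne
    have hPx := hP x h2.ne
    rw [← hexpT x h1 h2] at hQx hPx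
    rw [hQe] at hQx
    rw [hPe] at hPx
    have hd := hden (T x)
    have hpow : (r - x) ^ n ≠ 0 := pow_ne_zero _ hx
    have hq0 : q.eval x ≠ 0 := by
      intro h
      rw [h, mul_zero] at hQx
      exact (mul_ne_zero hpow hd.ne') hQx.symm
    rw [div_eq_iff hq0, hPx, hA]
    simp only
    rw [mul_right_comm, hQx, mul_assoc, ← mul_div_assoc, mul_div_cancel_left₀ _ hd.ne']
  have hAdiff : Differentiable ℝ A := by
    intro τ
    refine DifferentiableAt.fun_div (by fun_prop) (by fun_prop) (hden τ).ne'
  have hconst := const_of_deriv_mean_zeros (q := fun k => Q.coeff k) hQc a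
    (t := fun i => T (t i)) (fun i j hij => hTmono _ _ (by linarith [(htI i).1]) (ht hij)
      (by linarith [(htI j).2])) (by
    intro i
    change deriv A (T (t i)) = 0
    have h1 : -r < t i := by linarith [(htI i).1]
    have h2 : t i < r := by linarith [(htI i).2]
    have hq0 := eval_ne_zero_of_roots hroot (htI i)
    have hL : HasDerivAt (fun x => p.eval x / q.eval x) 0 (t i) := by
      refine ((p.hasDerivAt (t i)).fun_div (q.hasDerivAt (t i)) hq0).congr_deriv ?_
      have := h0 i
      rw [wr, eval_sub, eval_mul, eval_mul] at this
      rw [this, zero_div]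
    have hR : HasDerivAt (fun x => s * A (T x))
        (s * (deriv A (T (t i)) * (1 / (r + t i) + 1 / (r - t i)))) (t i) :=
      (((hAdiff _).hasDerivAt).comp (t i) (hdT _ h1 h2)).const_mul s
    have heq : (fun x => s * A (T x)) =ᶠ[nhds (t i)] fun x => p.eval x / q.eval x := by
      filter_upwards [Ioo_mem_nhds h1 h2] with x hx
      exact (hratio x hx.1 hx.2).symm
    have := (hL.congr_of_eventuallyEq heq).unique hR
    have hpos : 0 < 1 / (r + t i) + 1 / (r - t i) := by
      have : 0 < r + t i := by linarith
      have : 0 < r - t i := by linarith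
      positivity
    rcases mul_eq_zero.1 this.symm with h | h
    · exact absurd h hs
    · exact (mul_eq_zero.1 h).resolve_right hpos.ne')
  -- The mean of a constant sequence is that constant, so `p` is a multiple of `q`.
  have hpq : p = C (s * a 0) * q := by
    refine eq_of_infinite_eval_eq _ _ ((Ioo_infinite (neg_lt_self hr0)).mono ?_)
    intro x hx
    have hq0 : s * q.eval x ≠ 0 := by
      rw [hQ x hx.2.ne, ← hexpT x hx.1 hx.2, hQe]
      exact mul_ne_zero (pow_ne_zero _ (by linarith [hx.2])) (hden _).ne'
    have hq1 : q.eval x ≠ 0 := right_ne_zero_of_mul hq0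
    have := hratio x hx.1 hx.2
    have hAc : A (T x) = a 0 := by
      rw [hA]
      simp only
      rw [div_eq_iff (hden _).ne', Finset.mul_sum]
      refine Finset.sum_congr rfl fun k hk => ?_
      rw [hconst k (by simpa [Nat.lt_succ_iff] using hk)]
      ring
    rw [hAc, div_eq_iff hq1] at this
    simp [this]
  rw [hpq, wr, derivative_C_mul]
  ring

/-! ### Consequences of the Haar property: interpolation and alternation. -/

lemma wr_add (p₁ p₂ q : ℝ[X]) : wr (p₁ + p₂) q = wr p₁ q + wr p₂ q := by
  simp only [wr, derivative_add]; ring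

lemma wr_C_mul (c : ℝ) (p q : ℝ[X]) : wr (C c * p) q = C c * wr p q := by
  simp only [wr, derivative_C_mul]; ring

lemma wr_self (q : ℝ[X]) : wr q q = 0 := by
  simp only [wr]; ring

/-- The polynomial with coefficients `c`. -/
def ofCoeffs {n : ℕ} (c : Fin n → ℝ) : ℝ[X] := ∑ j : Fin n, C (c j) * X ^ (j : ℕ)

lemma degree_ofCoeffs_lt {n : ℕ} (c : Fin n → ℝ) : (ofCoeffs c).degree < n :=
  degree_sum_fin_lt c

lemma natDegree_ofCoeffs_le {n : ℕ} (c : Fin n → ℝ) : (ofCoeffs c).natDegree ≤ n :=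
  natDegree_le_of_degree_le (degree_ofCoeffs_lt c).le

lemma coeff_ofCoeffs {n : ℕ} (c : Fin n → ℝ) (j : Fin n) : (ofCoeffs c).coeff j = c j := by
  simp [ofCoeffs, finsetSum_coeff, coeff_X_pow, Fin.val_inj]

lemma wr_ofCoeffs {n : ℕ} (c : Fin n → ℝ) (q : ℝ[X]) :
    wr (ofCoeffs c) q = ∑ j : Fin n, C (c j) * wr (X ^ (j : ℕ)) q := by
  rw [ofCoeffs]
  have key : ∀ s : Finset (Fin n), wr (∑ j ∈ s, C (c j) * X ^ (j : ℕ)) q =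
      ∑ j ∈ s, C (c j) * wr (X ^ (j : ℕ)) q := by
    intro s
    induction s using Finset.cons_induction with
    | empty => simp [wr]
    | cons j s hj ih => rw [Finset.sum_cons, wr_add, wr_C_mul, ih, Finset.sum_cons]
  exact key _

lemma eval_wr_ofCoeffs {n : ℕ} (c : Fin n → ℝ) (q : ℝ[X]) (x : ℝ) :
    (wr (ofCoeffs c) q).eval x = ∑ j : Fin n, c j * (wr (X ^ (j : ℕ)) q).eval x := by
  rw [wr_ofCoeffs, eval_finsetSum]
  simp

section haar

variable {n : ℕ} {q : ℝ[X]}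

lemma wr_eq_zero_of_injective (hq : IsMonicOfDegree q n)
    (hroot : ∀ a : ℂ, aeval a q = 0 → 1 < ‖a‖) {p : ℝ[X]} (hp : p.natDegree ≤ n) {t : Fin n → ℝ}
    (ht : Function.Injective t) (htI : ∀ i, t i ∈ Icc (-1 : ℝ) 1)
    (h0 : ∀ i, (wr p q).eval (t i) = 0) : wr p q = 0 := by
  classical
  have hc : (Finset.univ.image t).card = n := by
    rw [Finset.card_image_of_injective _ ht, Finset.card_univ, Fintype.card_fin]
  have hmem : ∀ i, ∃ j, t j = (Finset.univ.image t).orderEmbOfFin hc i := fun i => by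
    obtain ⟨j, -, hj⟩ := Finset.mem_image.1 (Finset.orderEmbOfFin_mem (Finset.univ.image t) hc i)
    exact ⟨j, hj⟩
  refine wr_eq_zero_of_zeros hq hroot hp
    ((Finset.univ.image t).orderEmbOfFin hc).strictMono (fun i => ?_) (fun i => ?_)
  · obtain ⟨j, hj⟩ := hmem i
    rw [← hj]; exact htI j
  · obtain ⟨j, hj⟩ := hmem i
    rw [← hj]; exact h0 j

/-- Restricting to `deg < n = deg q` removes the kernel spanned by `q`; the Haar property then makes
the square evaluation system injective, hence surjective. -/
lemma exists_interpolation (hq : IsMonicOfDegree q n)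
    (hroot : ∀ a : ℂ, aeval a q = 0 → 1 < ‖a‖) {t : Fin n → ℝ}
    (ht : Function.Injective t) (htI : ∀ i, t i ∈ Icc (-1 : ℝ) 1) (y : Fin n → ℝ) :
    ∃ c : Fin n → ℝ, ∀ i, (wr (ofCoeffs c) q).eval (t i) = y i := by
  let L : (Fin n → ℝ) →ₗ[ℝ] (Fin n → ℝ) :=
    { toFun := fun c i => ∑ j : Fin n, c j * (wr (X ^ (j : ℕ)) q).eval (t i)
      map_add' := fun c d => by
        funext i
        simp [add_mul, Finset.sum_add_distrib]
      map_smul' := fun a c => by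
        funext i
        simp [mul_assoc, Finset.mul_sum] }
  have hL : ∀ c i, L c i = (wr (ofCoeffs c) q).eval (t i) := fun c i =>
    (eval_wr_ofCoeffs c q (t i)).symm
  have hinj : Function.Injective L := by
    rw [injective_iff_map_eq_zero]
    intro c hc
    have hw : wr (ofCoeffs c) q = 0 := by
      refine wr_eq_zero_of_injective hq hroot (natDegree_ofCoeffs_le c) ht htI fun i => ?_
      rw [← hL, hc]; rfl
    have hz : ofCoeffs c = 0 := by
      by_contra hne
      refine hne (eq_zero_of_wr_eq_zero ?_ hw)
      rw [hq.natDegree_eq]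
      exact (natDegree_lt_iff_degree_lt hne).2 (degree_ofCoeffs_lt c)
    funext j
    rw [← coeff_ofCoeffs c j, hz]; simp
  obtain ⟨c, hc⟩ := LinearMap.injective_iff_surjective.1 hinj y
  exact ⟨c, fun i => by rw [← hL, hc]⟩

lemma exists_zeros_of_sign_changes {m : ℕ} {g : ℝ → ℝ} (hg : Continuous g) {t : Fin (m + 1) → ℝ}
    (ht : StrictMono t) {σ : ℝ} (h : ∀ k : Fin (m + 1), 0 < σ * (-1) ^ (k : ℕ) * g (t k)) :
    ∃ s : Fin m → ℝ, StrictMono s ∧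
      ∀ i, s i ∈ Ioo (t i.castSucc) (t i.succ) ∧ g (s i) = 0 := by
  have hc : ∀ i : Fin m, ∃ c ∈ Ioo (t i.castSucc) (t i.succ), g c = 0 := by
    intro i
    have h1 := h i.castSucc
    have h2 := h i.succ
    have hlt := ht i.castSucc_lt_succ
    rw [Fin.val_succ, pow_succ] at h2
    rw [Fin.val_castSucc] at h1
    set a := σ * (-1) ^ (i : ℕ)
    have h2' : a * g (t i.succ) < 0 := by
      have : σ * ((-1) ^ (i : ℕ) * -1) * g (t i.succ) = -(a * g (t i.succ)) := by ring
      linarith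
    have ha : a ≠ 0 := by rintro h0; rw [h0, zero_mul] at h1; exact lt_irrefl _ h1
    obtain ⟨c, hc, hc0⟩ := intermediate_value_Ioo' hlt.le
      (f := fun x => a * g x) (by fun_prop) (show (0 : ℝ) ∈ Ioo _ _ from ⟨h2', h1⟩)
    exact ⟨c, hc, (mul_eq_zero.1 hc0).resolve_left ha⟩
  choose s hs hs0 using hc
  refine ⟨s, fun i j hij => ?_, fun i => ⟨hs i, hs0 i⟩⟩
  refine (hs i).2.trans_le (le_trans (ht.monotone ?_) (hs j).1.le)
  rw [Fin.le_def]
  simpa using hij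

/-- Weak sign alternation at `n + 1` points forces `wr p q` to vanish. -/
lemma wr_eq_zero_of_alternation (hq : IsMonicOfDegree q n)
    (hroot : ∀ a : ℂ, aeval a q = 0 → 1 < ‖a‖) {p : ℝ[X]} (hp : p.natDegree ≤ n)
    {t : Fin (n + 1) → ℝ} (ht : StrictMono t) (htI : ∀ i, t i ∈ Icc (-1 : ℝ) 1) {σ : ℝ}
    (hσ : σ ≠ 0) (h : ∀ k : Fin (n + 1), 0 ≤ σ * (-1) ^ (k : ℕ) * (wr p q).eval (t k)) : wr p q = 0 := by
  by_contra hne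
  obtain ⟨j, hj⟩ : ∃ j, (wr p q).eval (t j) ≠ 0 := by
    by_contra! hcon
    exact hne (wr_eq_zero_of_injective hq hroot hp (t := fun i => t i.castSucc)
      (ht.injective.comp (Fin.castSucc_injective n)) (fun i => htI _) fun i => hcon _)
  -- Weak signs are made strict by adding a small function with the right signs at all points but `t
  -- j`. At `t j` the value is already nonzero, and `ε` is small enough to keep its sign. Strict
  -- alternation then yields `n` zeros.
  obtain ⟨c, hc⟩ := exists_interpolation hq hroot (t := fun i => t (j.succAbove i))
    (ht.injective.comp Fin.succAbove_right_injective) (fun i => htI _)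
    (fun i => σ * (-1) ^ (j.succAbove i : ℕ))
  set g := (wr p q).eval (t j)
  set b := (wr (ofCoeffs c) q).eval (t j)
  set ε := |g| / (2 * (|b| + 1)) with hε
  have hg : 0 < |g| := abs_pos.2 hj
  have hε0 : 0 < ε := by positivity
  have hεb : |ε * b| < |g| := by
    rw [abs_mul, abs_of_pos hε0, hε, div_mul_eq_mul_div, div_lt_iff₀ (by positivity)]
    nlinarith [abs_nonneg b]
  have hdeg : (p + C ε * ofCoeffs c).natDegree ≤ n :=
    natDegree_add_le_of_degree_le hp ((natDegree_C_mul_le _ _).trans (natDegree_ofCoeffs_le c))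
  have hev : ∀ x, (wr (p + C ε * ofCoeffs c) q).eval x =
      (wr p q).eval x + ε * (wr (ofCoeffs c) q).eval x := by
    intro x
    rw [wr_add, wr_C_mul, eval_add, eval_mul, eval_C]
  have hpm : ∀ k : ℕ, ((-1 : ℝ) ^ k) * (-1) ^ k = 1 := fun k => by
    rw [← mul_pow]; simp
  have hsign : ∀ k : Fin (n + 1), 0 < σ * (-1) ^ (k : ℕ) * (wr (p + C ε * ofCoeffs c) q).eval (t k) := by
    intro k
    rw [hev]
    rcases eq_or_ne k j with rfl | hk
    · have h1 := h k
      have h2 : (σ * (-1) ^ (k : ℕ)) ≠ 0 := mul_ne_zero hσ (pow_ne_zero _ (by norm_num))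
      change 0 ≤ σ * (-1) ^ (k : ℕ) * g at h1
      change 0 < σ * (-1) ^ (k : ℕ) * (g + ε * b)
      set a := σ * (-1) ^ (k : ℕ)
      rcases abs_lt.1 hεb with ⟨h3, h4⟩
      rcases lt_or_gt_of_ne h2 with ha | ha
      · have hg0 : g ≤ 0 := by
          by_contra hcon
          exact absurd h1 (not_le.2 (mul_neg_of_neg_of_pos ha (not_le.1 hcon)))
        rw [abs_of_nonpos hg0] at h3 h4
        exact mul_pos_of_neg_of_neg ha (by linarith)
      · have hg0 : 0 ≤ g := by
          by_contra hcon
          exact absurd h1 (not_le.2 (mul_neg_of_pos_of_neg ha (not_le.1 hcon)))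
        rw [abs_of_nonneg hg0] at h3 h4
        exact mul_pos ha (by linarith)
    · obtain ⟨i, rfl⟩ := Fin.exists_succAbove_eq hk
      rw [hc i, mul_add]
      have h1 := h (j.succAbove i)
      have h2 : σ * (-1) ^ (j.succAbove i : ℕ) * (ε * (σ * (-1) ^ (j.succAbove i : ℕ))) =
          ε * σ ^ 2 := by
        linear_combination (ε * σ ^ 2) * hpm (j.succAbove i : ℕ)
      rw [h2]
      have : 0 < ε * σ ^ 2 := by positivity
      linarith
  obtain ⟨s, hs, hs0⟩ := exists_zeros_of_sign_changes
    (wr (p + C ε * ofCoeffs c) q).continuous ht hsign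
  have hz := wr_eq_zero_of_zeros hq hroot hdeg hs
    (fun i => ⟨(htI _).1.trans (hs0 i).1.1.le, (hs0 i).1.2.le.trans (htI _).2⟩)
    fun i => (hs0 i).2
  have := hsign j
  rw [hz] at this
  simp at this

end haar

/-! ### The deviation in terms of real polynomials; alternance implies optimality. -/

lemma exists_sign {p : ℝ[X]} (hp : ∀ x ∈ Icc (-1 : ℝ) 1, p.eval x ≠ 0) :
    ∃ s : ℝ, s ≠ 0 ∧ ∀ x ∈ Icc (-1 : ℝ) 1, 0 < s * p.eval x := by
  have h1 : p.eval (-1) ≠ 0 := hp _ (by norm_num)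
  refine ⟨p.eval (-1), h1, fun x hx => ?_⟩
  by_contra hcon
  obtain ⟨c, hc, hc0⟩ := intermediate_value_Icc' (f := fun y => p.eval (-1) * p.eval y) hx.1
    (by fun_prop) (show (0 : ℝ) ∈ Icc _ _ from ⟨not_lt.1 hcon, mul_self_nonneg _⟩)
  exact hp c ⟨hc.1, hc.2.trans hx.2⟩ ((mul_eq_zero.1 hc0).resolve_left h1)

section deviation

variable {f : ℝ → ℝ} {p : ℝ[X]}

lemma norm_sub_frac_aroots (hp : ∀ x ∈ Icc (-1 : ℝ) 1, p.eval x ≠ 0) {x : ℝ}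
    (hx : x ∈ Icc (-1 : ℝ) 1) :
    ‖(f x : ℂ) - frac (p.aroots ℂ) x‖ = |f x - realFrac p x| := by
  rw [frac_aroots p (hp x hx), ← Complex.ofReal_sub, Complex.norm_real, Real.norm_eq_abs]

lemma continuousOn_realFrac (hp : ∀ x ∈ Icc (-1 : ℝ) 1, p.eval x ≠ 0) :
    ContinuousOn (realFrac p) (Icc (-1) 1) :=
  (derivative p).continuous.continuousOn.div p.continuous.continuousOn hp

lemma deviation_aroots (hp : ∀ x ∈ Icc (-1 : ℝ) 1, p.eval x ≠ 0) :
    deviation f (p.aroots ℂ) = sSup ((fun x : ℝ => |f x - realFrac p x|) '' Icc (-1) 1) := by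
  rw [deviation]
  congr 1
  exact image_congr fun x hx => norm_sub_frac_aroots hp hx

lemma isCompact_errors (hf : ContinuousOn f (Icc (-1) 1))
    (hp : ∀ x ∈ Icc (-1 : ℝ) 1, p.eval x ≠ 0) :
    IsCompact ((fun x : ℝ => |f x - realFrac p x|) '' Icc (-1) 1) :=
  isCompact_Icc.image_of_continuousOn (hf.sub (continuousOn_realFrac hp)).abs

lemma abs_le_deviation (hf : ContinuousOn f (Icc (-1) 1))
    (hp : ∀ x ∈ Icc (-1 : ℝ) 1, p.eval x ≠ 0) {x : ℝ} (hx : x ∈ Icc (-1 : ℝ) 1) :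
    |f x - realFrac p x| ≤ deviation f (p.aroots ℂ) := by
  rw [deviation_aroots hp]
  exact le_csSup (isCompact_errors hf hp).bddAbove (mem_image_of_mem _ hx)

lemma exists_eq_deviation (hf : ContinuousOn f (Icc (-1) 1))
    (hp : ∀ x ∈ Icc (-1 : ℝ) 1, p.eval x ≠ 0) :
    ∃ x ∈ Icc (-1 : ℝ) 1, |f x - realFrac p x| = deviation f (p.aroots ℂ) := by
  rw [deviation_aroots hp]
  exact (isCompact_errors hf hp).sSup_mem ((nonempty_Icc.2 (by norm_num)).image _)

lemma deviation_eq_of {d : ℝ} (hf : ContinuousOn f (Icc (-1) 1))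
    (hp : ∀ x ∈ Icc (-1 : ℝ) 1, p.eval x ≠ 0) (hle : ∀ x ∈ Icc (-1 : ℝ) 1, |f x - realFrac p x| ≤ d)
    {y : ℝ} (hy : y ∈ Icc (-1 : ℝ) 1) (hyd : |f y - realFrac p y| = d) :
    deviation f (p.aroots ℂ) = d := by
  obtain ⟨x, hx, hxd⟩ := exists_eq_deviation hf hp
  refine le_antisymm (hxd ▸ hle x hx) (hyd ▸ abs_le_deviation hf hp hy)

lemma isAdmissible_aroots {n : ℕ} (hd : p.natDegree ≤ n)
    (hp : ∀ x ∈ Icc (-1 : ℝ) 1, p.eval x ≠ 0) : IsAdmissible n (p.aroots ℂ) := by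
  have h0 : p ≠ 0 := by
    rintro rfl
    exact hp 0 (by norm_num) eval_zero
  refine ⟨by rwa [card_aroots], isRealValued_aroots h0, fun x hx hm => ?_⟩
  exact hp x hx ((ofReal_mem_aroots h0).1 hm)

lemma IsAdmissible.exists_poly {n : ℕ} {z : Multiset ℂ} (hz : IsAdmissible n z) :
    ∃ p : ℝ[X], p.Monic ∧ p.aroots ℂ = z ∧ p.natDegree ≤ n ∧
      ∀ x ∈ Icc (-1 : ℝ) 1, p.eval x ≠ 0 := by
  obtain ⟨hc, hr, hI⟩ := hz
  obtain ⟨p, hp, rfl⟩ := exists_real_poly hr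
  refine ⟨p, hp, rfl, by rwa [card_aroots] at hc, fun x hx h0 => ?_⟩
  exact hI x hx ((ofReal_mem_aroots hp.ne_zero).2 h0)

lemma hasAlternance_aroots {m : ℕ} (hp : ∀ x ∈ Icc (-1 : ℝ) 1, p.eval x ≠ 0) :
    HasAlternance m f (p.aroots ℂ) ↔
      ∃ t : Fin m → ℝ, StrictMono t ∧ (∀ k, t k ∈ Icc (-1 : ℝ) 1) ∧
        ∃ σ : ℝ, (σ = 1 ∨ σ = -1) ∧
          ∀ k : Fin m, f (t k) - realFrac p (t k) =
            σ * (-1) ^ (k : ℕ) * deviation f (p.aroots ℂ) := by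
  refine exists_congr fun t => and_congr_right fun _ => and_congr_right fun hI =>
    exists_congr fun σ => and_congr_right fun _ => forall_congr' fun k => ?_
  rw [frac_aroots p (hp _ (hI k)), ← Complex.ofReal_sub, Complex.ofReal_inj]

end deviation

/-- A fraction at least as close to `f` as one with an alternance coincides with it. -/
theorem eq_of_alternance {n : ℕ} {f : ℝ → ℝ} {p q : ℝ[X]} (hf : ContinuousOn f (Icc (-1) 1))
    (hq : IsMonicOfDegree q n) (hroot : ∀ a : ℂ, aeval a q = 0 → 1 < ‖a‖)
    (halt : HasAlternance (n + 1) f (q.aroots ℂ)) (hpm : p.Monic) (hpd : p.natDegree ≤ n)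
    (hp : ∀ x ∈ Icc (-1 : ℝ) 1, p.eval x ≠ 0)
    (hle : deviation f (p.aroots ℂ) ≤ deviation f (q.aroots ℂ)) : p = q := by
  have hq0 : ∀ x ∈ Icc (-1 : ℝ) 1, q.eval x ≠ 0 := fun x hx => eval_ne_zero_of_roots hroot hx
  obtain ⟨t, ht, htI, σ, hσ, hk⟩ := (hasAlternance_aroots hq0).1 halt
  -- The denominator `p q` has constant sign `s`, so `wr p q` inherits the alternation of the
  -- difference of the fractions.
  obtain ⟨s, hs, hspos⟩ := exists_sign (p := p * q) fun x hx => by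
    rw [eval_mul]; exact mul_ne_zero (hp x hx) (hq0 x hx)
  have hσ0 : σ ≠ 0 := by rcases hσ with rfl | rfl <;> norm_num
  refine eq_of_wr_eq_zero hpm hq.monic ?_
  refine wr_eq_zero_of_alternation hq hroot hpd ht htI (mul_ne_zero hs hσ0) fun k => ?_
  have h1 := abs_le_deviation hf hp (htI k)
  have h2 := hk k
  have h3 := realFrac_sub_realFrac (hp _ (htI k)) (hq0 _ (htI k))
  have h4 := hspos _ (htI k)
  rw [eval_mul] at h4
  have hpq : p.eval (t k) * q.eval (t k) ≠ 0 := mul_ne_zero (hp _ (htI k)) (hq0 _ (htI k))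
  rw [eq_div_iff hpq] at h3
  rw [← h3]
  obtain ⟨h5, h6⟩ := abs_le.1 (h1.trans hle)
  -- Where the error of `q` is extremal, the error of `p` is no larger in modulus, so the difference
  -- of the errors has weakly the sign of the former.
  have hd : 0 ≤ σ * (-1) ^ (k : ℕ) * (realFrac p (t k) - realFrac q (t k)) := by
    set d := deviation f (q.aroots ℂ)
    have ha : σ * (-1) ^ (k : ℕ) = 1 ∨ σ * (-1) ^ (k : ℕ) = -1 := by
      rcases neg_one_pow_eq_or ℝ (k : ℕ) with h | h <;> rcases hσ with rfl | rfl <;> rw [h] <;> simp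
    rcases ha with ha | ha <;> rw [ha] at h2 ⊢ <;> linarith
  have : s * σ * (-1) ^ (k : ℕ) * ((realFrac p (t k) - realFrac q (t k)) *
      (p.eval (t k) * q.eval (t k))) = (σ * (-1) ^ (k : ℕ) * (realFrac p (t k) - realFrac q (t k))) *
      (s * (p.eval (t k) * q.eval (t k))) := by ring
  rw [this]
  exact mul_nonneg hd h4.le

/-! ### Optimality implies alternance. -/

open Filter Topology

/-- If `wr p q` has the sign of the error at all points of maximal error, then moving from `q` in
the direction of `p` improves the approximation. -/
theorem not_isBest_of_direction {n : ℕ} {f : ℝ → ℝ} {p q : ℝ[X]}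
    (hf : ContinuousOn f (Icc (-1) 1)) (hqd : q.natDegree ≤ n)
    (hq : ∀ x ∈ Icc (-1 : ℝ) 1, q.eval x ≠ 0) (hpd : p.natDegree ≤ n)
    (hdir : ∀ x ∈ Icc (-1 : ℝ) 1, |f x - realFrac q x| = deviation f (q.aroots ℂ) →
      0 < (f x - realFrac q x) * (wr p q).eval x) :
    ¬ IsBest n f (q.aroots ℂ) := by
  intro hbest
  set δ := deviation f (q.aroots ℂ) with hδ
  obtain ⟨B, hB⟩ : ∃ B : ℝ, ∀ x ∈ Icc (-1 : ℝ) 1, |p.eval x / q.eval x| ≤ B := by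
    obtain ⟨B, hB⟩ := (isCompact_Icc (a := (-1 : ℝ)) (b := 1)).exists_bound_of_continuousOn
      (f := fun x => p.eval x / q.eval x)
      (p.continuous.continuousOn.div q.continuous.continuousOn hq)
    exact ⟨B, fun x hx => hB x hx⟩
  have hB0 : 0 ≤ B := (abs_nonneg _).trans (hB 0 (by norm_num))
  -- The factor `1 / (B + 1)` ensures `1 + ε p/q > 0`, so every `q + ε p` is free of zeros on `[-1,
  -- 1]`.
  set ε : ℕ → ℝ := fun k => 1 / (B + 1) * (1 / ((k : ℝ) + 1)) with hε
  have hε0 : ∀ k, 0 < ε k := fun k => by positivity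
  have hε1 : ∀ k, ε k * B < 1 := by
    intro k
    have h1 : 1 / ((k : ℝ) + 1) ≤ 1 := by
      rw [div_le_one (by positivity)]
      have : (0 : ℝ) ≤ k := k.cast_nonneg
      linarith
    have h2 : 1 / (B + 1) * B < 1 := by
      rw [div_mul_eq_mul_div, div_lt_one (by positivity)]; linarith
    calc ε k * B = (1 / (B + 1) * B) * (1 / ((k : ℝ) + 1)) := by rw [hε]; ring
      _ ≤ (1 / (B + 1) * B) * 1 := mul_le_mul_of_nonneg_left h1 (by positivity)
      _ < 1 := by rwa [mul_one]
  have hεlim : Tendsto ε atTop (𝓝 0) := by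
    have := (tendsto_one_div_add_atTop_nhds_zero_nat (𝕜 := ℝ)).const_mul (1 / (B + 1))
    rwa [mul_zero] at this
  set P : ℕ → ℝ[X] := fun k => q + C (ε k) * p with hP
  have hPe : ∀ k x, (P k).eval x = q.eval x + ε k * p.eval x := fun k x => by simp [hP]
  have hPq : ∀ k, ∀ x ∈ Icc (-1 : ℝ) 1, 0 < (P k).eval x * q.eval x := by
    intro k x hx
    have h1 : (P k).eval x * q.eval x = q.eval x ^ 2 * (1 + ε k * (p.eval x / q.eval x)) := by
      have := hq x hx
      rw [hPe]; field_simp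
    have h2 : |ε k * (p.eval x / q.eval x)| < 1 := by
      rw [abs_mul, abs_of_pos (hε0 k)]
      exact (mul_le_mul_of_nonneg_left (hB x hx) (hε0 k).le).trans_lt (hε1 k)
    rw [h1]
    have := hq x hx
    have := (abs_lt.1 h2).1
    have h3 : 0 < 1 + ε k * (p.eval x / q.eval x) := by linarith
    positivity
  have hPne : ∀ k, ∀ x ∈ Icc (-1 : ℝ) 1, (P k).eval x ≠ 0 := fun k x hx =>
    left_ne_zero_of_mul (hPq k x hx).ne'
  have hPd : ∀ k, (P k).natDegree ≤ n := fun k =>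
    natDegree_add_le_of_degree_le hqd ((natDegree_C_mul_le _ _).trans hpd)
  -- Optimality of `q` gives for each perturbation a point with error at least `δ`. A limit `y` of
  -- such points is extremal for `q`, and there the direction turns out not to have the sign of the
  -- error.
  have hx : ∀ k, ∃ x ∈ Icc (-1 : ℝ) 1, δ ≤ |f x - realFrac (P k) x| := by
    intro k
    obtain ⟨x, hxI, hx⟩ := exists_eq_deviation hf (hPne k)
    exact ⟨x, hxI, hx ▸ hbest.2 _ (isAdmissible_aroots (hPd k) (hPne k))⟩
  choose x hxI hx using hx
  obtain ⟨y, hyI, φ, hφ, hlim⟩ := isCompact_Icc.tendsto_subseq hxI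
  set e : ℝ → ℝ := fun x => f x - realFrac q x with he
  have hec : ContinuousOn e (Icc (-1) 1) := hf.sub (continuousOn_realFrac hq)
  have helim : Tendsto (fun k => e (x (φ k))) atTop (𝓝 (e y)) :=
    ((hec y hyI).tendsto).comp (tendsto_nhdsWithin_iff.2
      ⟨hlim, Eventually.of_forall fun k => hxI (φ k)⟩)
  set w : ℝ → ℝ := fun x => (wr p q).eval x with hw
  have hwlim : Tendsto (fun k => w (x (φ k))) atTop (𝓝 (w y)) :=
    ((wr p q).continuous.tendsto y).comp hlim
  have hε' : Tendsto (fun k => ε (φ k)) atTop (𝓝 0) := hεlim.comp hφ.tendsto_atTop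
  set D : ℕ → ℝ := fun k => (P (φ k)).eval (x (φ k)) * q.eval (x (φ k)) with hD
  have hD0 : ∀ k, 0 < D k := fun k => hPq _ _ (hxI _)
  have hDlim : Tendsto D atTop (𝓝 (q.eval y * q.eval y)) := by
    have hqlim : Tendsto (fun k => q.eval (x (φ k))) atTop (𝓝 (q.eval y)) :=
      (q.continuous.tendsto y).comp hlim
    have hplim : Tendsto (fun k => p.eval (x (φ k))) atTop (𝓝 (p.eval y)) :=
      (p.continuous.tendsto y).comp hlim
    have := (hqlim.add (hε'.mul hplim)).mul hqlim
    rw [zero_mul, add_zero] at this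
    refine this.congr fun k => ?_
    rw [hD]
    simp only
    rw [hPe]
  have hdiff : ∀ k, (f (x (φ k)) - realFrac (P (φ k)) (x (φ k))) * D k =
      e (x (φ k)) * D k - ε (φ k) * w (x (φ k)) := by
    intro k
    have h1 := realFrac_sub_realFrac (hPne (φ k) _ (hxI _)) (hq _ (hxI (φ k)))
    have h2 : (wr (P (φ k)) q).eval (x (φ k)) = ε (φ k) * w (x (φ k)) := by
      rw [hP]
      simp only
      rw [wr_add, wr_self, wr_C_mul, zero_add, eval_mul, eval_C]
    rw [h2, eq_div_iff (hD0 k).ne'] at h1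
    rw [he]
    simp only
    linear_combination -h1
  have hqy : 0 < q.eval y * q.eval y := mul_self_pos.2 (hq y hyI)
  have hδ0 : 0 ≤ δ := (abs_nonneg _).trans (abs_le_deviation hf hq hyI)
  have hey : |e y| = δ := by
    refine le_antisymm (abs_le_deviation hf hq hyI) ?_
    have h1 : ∀ k, δ * D k ≤ |e (x (φ k)) * D k - ε (φ k) * w (x (φ k))| := by
      intro k
      rw [← hdiff, abs_mul, abs_of_pos (hD0 k)]
      exact mul_le_mul_of_nonneg_right (hx (φ k)) (hD0 k).le
    have h2 := le_of_tendsto_of_tendsto' (hDlim.const_mul δ)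
      ((helim.mul hDlim).sub (hε'.mul hwlim)).abs h1
    rw [zero_mul, sub_zero, abs_mul, abs_of_pos hqy] at h2
    exact le_of_mul_le_mul_right h2 hqy
  have hfin : 2 * (e y * w y) * (q.eval y * q.eval y) ≤ 0 := by
    -- Comparing the squares of the two errors and dividing by `ε` leaves the first-order term,
    -- bounded by a quantity that tends to zero.
    have h1 : ∀ k, 2 * (e (x (φ k)) * w (x (φ k))) * D k ≤ ε (φ k) * w (x (φ k)) ^ 2 := by
      intro k
      have h3 : (e (x (φ k)) * D k) ^ 2 ≤ (e (x (φ k)) * D k - ε (φ k) * w (x (φ k))) ^ 2 := by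
        rw [← hdiff, mul_pow (e _) (D k), mul_pow (_ - _) (D k)]
        refine mul_le_mul_of_nonneg_right ?_ (sq_nonneg (D k))
        rw [sq_le_sq]
        exact (abs_le_deviation hf hq (hxI (φ k))).trans (hx (φ k))
      have h4 : 0 ≤ ε (φ k) * (ε (φ k) * w (x (φ k)) ^ 2 - 2 * (e (x (φ k)) * w (x (φ k))) * D k) := by
        nlinarith [h3]
      have := nonneg_of_mul_nonneg_right h4 (hε0 (φ k))
      linarith
    have h2 := le_of_tendsto_of_tendsto' (((helim.mul hwlim).const_mul 2).mul hDlim)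
      (hε'.mul (hwlim.pow 2)) h1
    rwa [zero_mul] at h2
  have := hdir y hyI hey
  have h5 : 0 < 2 * (e y * w y) * (q.eval y * q.eval y) := by positivity
  linarith

/-- By Carathéodory the hull is a finite union of continuous images of products of a simplex with
powers of `K`. -/
lemma isCompact_convexHull_of_isCompact {E : Type*} [NormedAddCommGroup E] [NormedSpace ℝ E]
    [FiniteDimensional ℝ E] {K : Set E} (hK : IsCompact K) : IsCompact (convexHull ℝ K) := by
  have hrep : convexHull ℝ K = ⋃ m ∈ Finset.range (Module.finrank ℝ E + 2),
      (fun y : (Fin m → ℝ) × (Fin m → E) => ∑ i, y.1 i • y.2 i) ''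
        (stdSimplex ℝ (Fin m) ×ˢ Set.pi univ fun _ => K) := by
    apply Subset.antisymm
    · intro x hx
      obtain ⟨ι, _, z, w, hz, hind, hw, hw1, hx⟩ := eq_pos_convex_span_of_mem_convexHull hx
      have hcard : Fintype.card ι < Module.finrank ℝ E + 2 := by
        have h1 := hind.card_le_finrank_succ
        have h2 := Submodule.finrank_le (vectorSpan ℝ (Set.range z))
        omega
      let φ := (Fintype.equivFin ι).symm
      refine mem_biUnion (Finset.mem_coe.2 (Finset.mem_range.2 hcard))
        ⟨(fun i => w (φ i), fun i => z (φ i)), ⟨⟨fun i => (hw _).le, ?_⟩, fun i _ => hz ⟨_, rfl⟩⟩, ?_⟩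
      · rw [← hw1]; exact Equiv.sum_comp φ w
      · rw [← hx]; exact Equiv.sum_comp φ fun i => w i • z i
    · refine iUnion₂_subset fun m _ => ?_
      rintro _ ⟨⟨w, z⟩, ⟨hw, hz⟩, rfl⟩
      exact (convex_convexHull ℝ K).sum_mem (fun i _ => hw.1 i) hw.2
        fun i _ => subset_convexHull ℝ K (hz i (mem_univ i))
  rw [hrep]
  refine Finset.isCompact_biUnion _ fun m _ => ?_
  exact ((isCompact_stdSimplex ℝ (Fin m)).prod (isCompact_univ_pi fun _ => hK)).image (by fun_prop)

section necessity

variable {n : ℕ} {q : ℝ[X]}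

/-- Take `g` equal to `1` at `t k.castSucc` and `0` at the other points except `t k.succ`. Then `g
(t k.succ) > 0`: a negative value would create an `n`-th zero, and the value `0` contradicts the
relation. The relation now reduces to these two terms. -/
lemma opposite_signs (hq : IsMonicOfDegree q n)
    (hroot : ∀ a : ℂ, aeval a q = 0 → 1 < ‖a‖) {t : Fin (n + 1) → ℝ} (ht : StrictMono t)
    (htI : ∀ i, t i ∈ Icc (-1 : ℝ) 1) {μ : Fin (n + 1) → ℝ} (hμ : ∀ k, μ k ≠ 0)
    (hrel : ∀ c : Fin n → ℝ, ∑ k, μ k * (wr (ofCoeffs c) q).eval (t k) = 0) (k : Fin n) :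
    μ k.castSucc * μ k.succ < 0 := by
  classical
  obtain ⟨c, hc⟩ := exists_interpolation hq hroot (t := fun i => t (k.succ.succAbove i))
    (ht.injective.comp Fin.succAbove_right_injective) (fun i => htI _)
    (fun i => if i = k then 1 else 0)
  set g := wr (ofCoeffs c) q with hg
  have hgk : g.eval (t k.castSucc) = 1 := by
    have := hc k
    rwa [Fin.succAbove_succ_self, if_pos rfl] at this
  have hsum := hrel c
  rw [Fin.sum_univ_succAbove _ k.succ, Finset.sum_eq_single k, Fin.succAbove_succ_self, ← hg, hgk,
    mul_one] at hsum
  rotate_left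
  · intro i _ hi
    rw [hc i, if_neg hi, mul_zero]
  · simp
  have hlt := ht k.castSucc_lt_succ
  have hpos : 0 < g.eval (t k.succ) := by
    rcases lt_trichotomy (g.eval (t k.succ)) 0 with h | h | h
    · exfalso
      obtain ⟨d, hd, hd0⟩ := intermediate_value_Ioo' hlt.le (f := fun x => g.eval x)
        (by fun_prop) (show (0 : ℝ) ∈ Ioo _ _ from ⟨h, by rw [hgk]; norm_num⟩)
      have hoff : ∀ i, i ≠ k → t (k.succ.succAbove i) ≠ d := by
        intro i hi heq
        rw [← heq] at hd
        have h1 := ht.lt_iff_lt.1 hd.1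
        have h2 := ht.lt_iff_lt.1 hd.2
        rw [Fin.lt_def] at h1 h2
        simp only [Fin.val_castSucc, Fin.val_succ] at h1 h2
        omega
      have hz : g = 0 := by
        refine wr_eq_zero_of_injective hq hroot (natDegree_ofCoeffs_le c)
          (t := fun i => if i = k then d else t (k.succ.succAbove i)) ?_ ?_ ?_
        · intro i j hij
          by_cases hi : i = k <;> by_cases hj : j = k
          · rw [hi, hj]
          · simp only [hi, hj, if_true, if_false] at hij
            exact absurd hij.symm (hoff j hj)
          · simp only [hi, hj, if_true, if_false] at hij
            exact absurd hij (hoff i hi)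
          · simp only [hi, hj, if_false] at hij
            exact Fin.succAbove_right_injective (ht.injective hij)
        · intro i
          by_cases hi : i = k
          · simp only [hi, if_true]
            exact ⟨(htI _).1.trans hd.1.le, hd.2.le.trans (htI _).2⟩
          · simp only [hi, if_false]
            exact htI _
        · intro i
          by_cases hi : i = k
          · simp only [hi, if_true]
            exact hd0
          · simp only [hi, if_false]
            rw [hc i, if_neg hi]
      rw [hz] at hgk
      simp at hgk
    · exfalso
      rw [h, mul_zero, zero_add] at hsum
      exact hμ _ hsum
    · exact h
  have h1 : μ k.castSucc = -(μ k.succ * g.eval (t k.succ)) := by linarith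
  rw [h1]
  have := hμ k.succ
  have h2 : 0 < μ k.succ ^ 2 * g.eval (t k.succ) := by positivity
  nlinarith

/-- A best approximant with poles outside the closed unit disc has an alternance. -/
theorem hasAlternance_of_isBest {f : ℝ → ℝ} (hf : ContinuousOn f (Icc (-1) 1))
    (hq : IsMonicOfDegree q n) (hroot : ∀ a : ℂ, aeval a q = 0 → 1 < ‖a‖)
    (hbest : IsBest n f (q.aroots ℂ)) : HasAlternance (n + 1) f (q.aroots ℂ) := by
  classical
  have hq0 : ∀ x ∈ Icc (-1 : ℝ) 1, q.eval x ≠ 0 := fun x hx => eval_ne_zero_of_roots hroot hx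
  rw [hasAlternance_aroots hq0]
  set δ := deviation f (q.aroots ℂ) with hδ
  set e : ℝ → ℝ := fun x => f x - realFrac q x with he
  have hec : ContinuousOn e (Icc (-1) 1) := hf.sub (continuousOn_realFrac hq0)
  have hle : ∀ x ∈ Icc (-1 : ℝ) 1, |e x| ≤ δ := fun x hx => abs_le_deviation hf hq0 hx
  have hδ0 : 0 ≤ δ := (abs_nonneg _).trans (hle 0 (by norm_num))
  rcases hδ0.eq_or_lt with hδz | hδpos
  · refine ⟨fun k => (k : ℝ) / (n + 1), fun i j hij => ?_, fun k => ⟨?_, ?_⟩, 1, Or.inl rfl, ?_⟩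
    · have : ((i : ℕ) : ℝ) < ((j : ℕ) : ℝ) := by exact_mod_cast hij
      simp only
      gcongr
    · have : (0 : ℝ) ≤ (k : ℝ) / (n + 1) := by positivity
      linarith
    · rw [div_le_one (by positivity)]
      have : ((k : ℕ) : ℝ) < ((n + 1 : ℕ) : ℝ) := by exact_mod_cast k.2
      push_cast at this
      linarith
    · intro k
      rw [← hδz, mul_zero]
      have hk : (k : ℝ) / (n + 1) ∈ Icc (-1 : ℝ) 1 := by
        constructor
        · have : (0 : ℝ) ≤ (k : ℝ) / (n + 1) := by positivity
          linarith
        · rw [div_le_one (by positivity)]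
          have : ((k : ℕ) : ℝ) < ((n + 1 : ℕ) : ℝ) := by exact_mod_cast k.2
          push_cast at this
          linarith
      have := hle _ hk
      rw [← hδz] at this
      exact abs_nonpos_iff.1 this
  set M : Set ℝ := {x ∈ Icc (-1 : ℝ) 1 | |e x| = δ} with hM
  have hMc : IsCompact M := by
    have : M = Icc (-1 : ℝ) 1 ∩ (fun x => |e x|) ⁻¹' {δ} := rfl
    rw [this]
    exact isCompact_Icc.of_isClosed_subset
      (hec.abs.preimage_isClosed_of_isClosed isClosed_Icc isClosed_singleton) inter_subset_left
  set v : ℝ → Fin n → ℝ := fun x j => (wr (X ^ (j : ℕ)) q).eval x with hv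
  have hvc : Continuous v := continuous_pi fun j => (wr (X ^ (j : ℕ)) q).continuous
  set K : Set (Fin n → ℝ) := (fun x => e x • v x) '' M with hK
  have hKc : IsCompact K :=
    hMc.image_of_continuousOn ((hec.mono fun x hx => hx.1).smul hvc.continuousOn)
  have hne : ∀ x ∈ M, e x ≠ 0 := fun x hx h0 => by
    have := hx.2
    rw [h0, abs_zero] at this
    exact hδpos.ne this
  -- Otherwise a functional positive on the hull supplies the coefficients of an improving
  -- direction.
  have h0mem : (0 : Fin n → ℝ) ∈ convexHull ℝ K := by
    by_contra h0
    obtain ⟨l, u, hu, hl⟩ := geometric_hahn_banach_point_closed (convex_convexHull ℝ K)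
      (isCompact_convexHull_of_isCompact hKc).isClosed h0
    rw [map_zero] at hu
    refine not_isBest_of_direction hf hq.natDegree_eq.le hq0
      (natDegree_ofCoeffs_le fun j => l (Pi.single j 1)) (fun x hx hxe => ?_) hbest
    have h1 := hu.trans (hl _ (subset_convexHull ℝ K ⟨x, ⟨hx, hxe⟩, rfl⟩))
    have h2 : l (e x • v x) = e x * ∑ j, v x j * l (Pi.single j 1) := by
      rw [map_smul, smul_eq_mul]
      congr 1
      conv_lhs => rw [pi_eq_sum_univ' (v x)]
      rw [map_sum]
      refine Finset.sum_congr rfl fun j _ => ?_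
      rw [map_smul, smul_eq_mul]
    rw [h2] at h1
    rw [eval_wr_ofCoeffs]
    simpa [hv, mul_comm] using h1
  -- Carathéodory gives a positive relation supported on at most `n + 1` extremal points.
  obtain ⟨ι, _, z, w, hz, hind, hw, hw1, hwz⟩ := eq_pos_convex_span_of_mem_convexHull h0mem
  have hx : ∀ i, ∃ x ∈ M, e x • v x = z i := fun i => hz ⟨i, rfl⟩
  choose x hxM hxz using hx
  have hxinj : Function.Injective x := fun i j hij => by
    apply hind.injective
    rw [← hxz, ← hxz, hij]
  have hrel : ∀ c : Fin n → ℝ, ∑ i, w i * e (x i) * (wr (ofCoeffs c) q).eval (x i) = 0 := by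
    intro c
    have h1 : ∀ j, ∑ i, w i * (e (x i) * v (x i) j) = 0 := by
      intro j
      have := congrFun hwz j
      simp only [← hxz, Finset.sum_apply, Pi.smul_apply, smul_eq_mul, Pi.zero_apply] at this
      exact this
    simp only [eval_wr_ofCoeffs, Finset.mul_sum]
    rw [Finset.sum_comm]
    refine Finset.sum_eq_zero fun j _ => ?_
    have h2 := congrArg (fun a => c j * a) (h1 j)
    simp only [mul_zero, Finset.mul_sum] at h2
    rw [← h2]
    exact Finset.sum_congr rfl fun i _ => by simp only [hv]; ring
  have hcard : Fintype.card ι ≤ n + 1 := by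
    have h1 := hind.card_le_finrank_succ
    have h2 := Submodule.finrank_le (vectorSpan ℝ (Set.range z))
    rw [Module.finrank_fin_fun] at h2
    omega
  have hSc : (Finset.univ.image x).card = Fintype.card ι := by
    rw [Finset.card_image_of_injective _ hxinj, Finset.card_univ]
  have hιne : (Finset.univ : Finset ι).Nonempty := by
    by_contra h
    rw [Finset.not_nonempty_iff_eq_empty] at h
    rw [h, Finset.sum_empty] at hw1
    exact zero_ne_one hw1
  rcases Nat.lt_or_ge n (Fintype.card ι) with hlt | hge
  · have hSn : (Finset.univ.image x).card = n + 1 := by omega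
    set t := (Finset.univ.image x).orderEmbOfFin hSn with ht
    have hmem : ∀ k, ∃ i, x i = t k := fun k => by
      obtain ⟨i, -, hi⟩ := Finset.mem_image.1 (Finset.orderEmbOfFin_mem (Finset.univ.image x) hSn k)
      exact ⟨i, hi⟩
    choose ψ hψ using hmem
    have hψinj : Function.Injective ψ := fun a b hab => by
      apply t.injective
      rw [← hψ, ← hψ, hab]
    have hψbij : Function.Bijective ψ :=
      (Fintype.bijective_iff_injective_and_card ψ).2 ⟨hψinj, by rw [Fintype.card_fin]; omega⟩
    have htM : ∀ k, t k ∈ M := fun k => by rw [← hψ]; exact hxM _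
    have hopp := opposite_signs hq hroot t.strictMono (fun k => (htM k).1)
      (μ := fun k => w (ψ k) * e (t k)) (fun k => mul_ne_zero (hw _).ne' (hne _ (htM k)))
      (fun c => by
        rw [← hrel c, ← hψbij.sum_comp]
        exact Finset.sum_congr rfl fun k _ => by rw [hψ])
    have hflip : ∀ k : Fin n, e (t k.succ) = -e (t k.castSucc) := by
      intro k
      have h1 : e (t k.castSucc) * e (t k.succ) < 0 := by
        have h2 : (w (ψ k.castSucc) * w (ψ k.succ)) * (e (t k.castSucc) * e (t k.succ)) < 0 := by
          have := hopp k
          nlinarith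
        exact (pos_iff_neg_of_mul_neg h2).1 (mul_pos (hw _) (hw _))
      have h3 : |e (t k.succ)| = |e (t k.castSucc)| := (htM _).2.trans (htM _).2.symm
      rcases abs_eq_abs.1 h3 with h | h
      · rw [h] at h1
        exact absurd h1 (not_lt.2 (mul_self_nonneg _))
      · exact h
    have hall : ∀ k : Fin (n + 1), e (t k) = (-1) ^ (k : ℕ) * e (t 0) := by
      intro k
      induction k using Fin.induction with
      | zero => simp
      | succ k ih =>
        rw [hflip, ih, Fin.val_succ, pow_succ, Fin.val_castSucc]
        ring
    refine ⟨t, t.strictMono, fun k => (htM k).1, e (t 0) / δ, ?_, fun k => ?_⟩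
    · rcases abs_choice (e (t 0)) with h | h
      · left
        rw [(htM 0).2] at h
        rw [← h, div_self hδpos.ne']
      · right
        rw [(htM 0).2] at h
        rw [h, div_neg, div_self (hne _ (htM 0))]
    · change e (t k) = _
      rw [hall]
      field_simp
  · exfalso
    -- With at most `n` points, pad them to exactly `n` and interpolate the error itself; the
    -- relation would then be a positive sum equal to zero.
    obtain ⟨S, hS, hScard, hSI⟩ : ∃ S : Finset ℝ, Finset.univ.image x ⊆ S ∧ S.card = n ∧
        (S : Set ℝ) ⊆ Icc (-1) 1 := by
      have hinf : (Icc (-1 : ℝ) 1).Infinite := Icc_infinite (by norm_num)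
      obtain ⟨S, h1, h2⟩ := (hinf.sdiff (Finset.finite_toSet
        (Finset.univ.image x))).exists_subset_card_eq (n - Fintype.card ι)
      refine ⟨Finset.univ.image x ∪ S, Finset.subset_union_left, ?_, ?_⟩
      · rw [Finset.card_union_of_disjoint, hSc, h2]
        · omega
        · exact Finset.disjoint_right.2 fun a ha => (h1 ha).2
      · intro a ha
        rcases Finset.mem_union.1 (Finset.mem_coe.1 ha) with h | h
        · obtain ⟨i, -, rfl⟩ := Finset.mem_image.1 h
          exact (hxM i).1
        · exact (h1 h).1
    set t := S.orderEmbOfFin hScard with ht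
    obtain ⟨c, hc⟩ := exists_interpolation hq hroot t.injective
      (fun i => hSI (Finset.orderEmbOfFin_mem S hScard i)) (fun i => e (t i))
    have hxe : ∀ i, (wr (ofCoeffs c) q).eval (x i) = e (x i) := by
      intro i
      have h1 : x i ∈ Set.range t := by
        rw [ht, Finset.range_orderEmbOfFin]
        exact hS (Finset.mem_image_of_mem _ (Finset.mem_univ i))
      obtain ⟨k, hk⟩ := h1
      rw [← hk]; exact hc k
    have h1 := hrel c
    have h2 : 0 < ∑ i, w i * e (x i) * (wr (ofCoeffs c) q).eval (x i) := by
      refine Finset.sum_pos (fun i _ => ?_) hιne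
      rw [hxe, mul_assoc]
      exact mul_pos (hw i) (mul_self_pos.2 (hne _ (hxM i)))
    exact h2.ne' h1

end necessity

/-! ### Sharpness: poles in the open disc and on the circle. -/

/-- The real quadratic polynomial with zeros `a` and its conjugate. -/
def conjQuad (a : ℂ) : ℝ[X] := X ^ 2 + C (-2 * a.re) * X + C (a.re ^ 2 + a.im ^ 2)

lemma eval_conjQuad (a : ℂ) (x : ℝ) : (conjQuad a).eval x = (x - a.re) ^ 2 + a.im ^ 2 := by
  simp only [conjQuad, eval_add, eval_mul, eval_pow, eval_X, eval_C]
  ring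

lemma derivative_conjQuad (a : ℂ) : derivative (conjQuad a) = C 2 * X + C (-2 * a.re) := by
  simp only [conjQuad, derivative_add, derivative_X_pow, derivative_C, derivative_mul,
    derivative_X]
  simp

lemma map_conjQuad (a : ℂ) :
    (conjQuad a).map (algebraMap ℝ ℂ) = (X - C a) * (X - C ((starRingEnd ℂ) a)) := by
  have h1 : (-2 * (a.re : ℂ)) = -(a + (starRingEnd ℂ) a) := by
    rw [Complex.add_conj]; push_cast; ring
  have h2 : ((a.re : ℂ) ^ 2 + (a.im : ℂ) ^ 2) = a * (starRingEnd ℂ) a := by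
    rw [Complex.mul_conj, Complex.normSq_apply]; push_cast; ring
  simp only [conjQuad, Polynomial.map_add, Polynomial.map_mul, Polynomial.map_pow, map_X, map_C,
    Complex.coe_algebraMap]
  push_cast
  rw [h1, h2]
  simp only [map_add, map_neg, map_mul]
  ring

/-- The monic polynomial with zeros `a`, its conjugate and the real numbers in `b`. -/
def conjQuadMul (a : ℂ) (b : Multiset ℝ) : ℝ[X] := conjQuad a * (b.map fun y => X - C y).prod

lemma map_conjQuadMul (a : ℂ) (b : Multiset ℝ) :
    (conjQuadMul a b).map (algebraMap ℝ ℂ) =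
      ((a ::ₘ (starRingEnd ℂ) a ::ₘ b.map fun y : ℝ => (y : ℂ)).map fun y => X - C y).prod := by
  rw [conjQuadMul, Polynomial.map_mul, map_conjQuad, Multiset.map_cons, Multiset.map_cons,
    Multiset.prod_cons, Multiset.prod_cons, ← mul_assoc]
  congr 1
  rw [Polynomial.map_multiset_prod, Multiset.map_map, Multiset.map_map]
  congr 1
  refine Multiset.map_congr rfl fun y _ => ?_
  simp

lemma aroots_conjQuadMul (a : ℂ) (b : Multiset ℝ) :
    (conjQuadMul a b).aroots ℂ = a ::ₘ (starRingEnd ℂ) a ::ₘ b.map fun y : ℝ => (y : ℂ) := by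
  rw [aroots, map_conjQuadMul, roots_multiset_prod_X_sub_C]

lemma conjQuadMul_cons (a : ℂ) (b : Multiset ℝ) (y : ℝ) :
    conjQuadMul a (y ::ₘ b) = conjQuadMul a b * (X - C y) := by
  rw [conjQuadMul, conjQuadMul, Multiset.map_cons, Multiset.prod_cons]
  ring

lemma natDegree_conjQuadMul (a : ℂ) (b : Multiset ℝ) :
    (conjQuadMul a b).natDegree = b.card + 2 := by
  rw [← card_aroots, aroots_conjQuadMul]
  simp

lemma eval_conjQuadMul_ne_zero {a : ℂ} (ha : a.im ≠ 0) {b : Multiset ℝ} (hb : ∀ y ∈ b, 1 < y)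
    {x : ℝ} (hx : x ∈ Icc (-1 : ℝ) 1) : (conjQuadMul a b).eval x ≠ 0 := by
  rw [conjQuadMul, eval_mul, eval_conjQuad, eval_multiset_prod, Multiset.map_map]
  refine mul_ne_zero (by positivity) ?_
  rw [Ne, Multiset.prod_eq_zero_iff, Multiset.mem_map]
  rintro ⟨y, hy, h⟩
  simp only [Function.comp_apply, eval_sub, eval_X, eval_C] at h
  linarith [hb y hy, hx.2]

/-- This is the numerator of the derivative of `p/q - A/(X - b)`, namely of `(p/q)' + A/(x - b)²`.
-/
lemma wr_mul_linear (p q : ℝ[X]) (b A : ℝ) :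
    wr (p * (X - C b) - C A * q) (q * (X - C b)) = wr p q * (X - C b) ^ 2 + C A * q ^ 2 := by
  simp only [wr, derivative_sub, derivative_mul, derivative_X, derivative_C]
  ring

/-- With suitable real poles to the right of `1`, the numerator `wr p q` can change sign `m + 2`
times on `[-1, 1)`, where `m` is the number of these poles. -/
lemma exists_oscillating {a : ℂ} (ha : a.im ≠ 0) (ha1 : ‖a‖ < 1) (m : ℕ) :
    ∃ (b : Multiset ℝ) (p : ℝ[X]) (t : Fin (m + 3) → ℝ) (σ : ℝ), b.card = m ∧ (∀ y ∈ b, 1 < y) ∧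
      p.natDegree ≤ m + 2 ∧ StrictMono t ∧ (∀ k, t k ∈ Ico (-1 : ℝ) 1) ∧ (σ = 1 ∨ σ = -1) ∧
      ∀ k : Fin (m + 3), 0 < σ * (-1) ^ (k : ℕ) * (wr p (conjQuadMul a b)).eval (t k) := by
  induction m with
  | zero =>
    have hβ : a.re ^ 2 + a.im ^ 2 = ‖a‖ ^ 2 := by
      rw [Complex.sq_norm, Complex.normSq_apply]; ring
    have hn0 : 0 < ‖a‖ := norm_pos_iff.2 (by rintro rfl; simp at ha)
    have hw : ∀ x, (wr X (conjQuadMul a 0)).eval x = ‖a‖ ^ 2 - x ^ 2 := by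
      intro x
      have : conjQuadMul a 0 = conjQuad a := by simp [conjQuadMul]
      rw [this, wr, derivative_conjQuad, derivative_X, eval_sub, eval_mul, eval_mul,
        eval_conjQuad]
      simp only [eval_one, eval_add, eval_mul, eval_C, eval_X]
      rw [← hβ]
      ring
    -- For `p = X` the numerator is `‖a‖² - x²`, and these points separate its zeros `±‖a‖`.
    refine ⟨0, X, ![-1, 0, (1 + ‖a‖) / 2], -1, rfl, by simp, by simp, ?_, ?_, Or.inr rfl, ?_⟩
    · rw [Fin.strictMono_iff_lt_succ]
      intro i
      fin_cases i
      · simp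
      · simp; positivity
    · intro k
      fin_cases k
      · simp
      · simp
      · constructor
        · simp; linarith
        · simp; linarith
    · intro k
      rw [hw]
      fin_cases k
      · simp; nlinarith
      · simp; positivity
      · simp; nlinarith
  | succ m ih =>
    obtain ⟨b, p, t, σ, hbc, hb, hp, ht, htI, hσ, hpos⟩ := ih
    set q := conjQuadMul a b with hq
    set w := wr p q with hw
    have hq1 : q.eval 1 ≠ 0 := eval_conjQuadMul_ne_zero ha hb (by norm_num)
    -- The added term `A/(x - y)²` with `A = τ K (y - 1)²` equals `τ K` at `x = 1`, where it
    -- dominates `(p/q)'`; at the old points, all less than `1`, it tends to zero as `y → 1`.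
    set K := (|w.eval 1| + 1) / q.eval 1 ^ 2 with hK
    set τ := σ * (-1) ^ (m + 3) with hτ
    have hτ1 : τ = 1 ∨ τ = -1 := by
      rcases neg_one_pow_eq_or ℝ (m + 3) with h | h <;> rcases hσ with rfl | rfl <;>
        rw [hτ, h] <;> simp
    have hev : ∀ᶠ y in 𝓝[>] (1 : ℝ), ∀ k : Fin (m + 3), 0 < σ * (-1) ^ (k : ℕ) *
        (w.eval (t k) * (t k - y) ^ 2 + τ * K * (y - 1) ^ 2 * q.eval (t k) ^ 2) := by
      rw [eventually_all]
      intro k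
      have hc : Continuous fun y : ℝ => σ * (-1) ^ (k : ℕ) *
        (w.eval (t k) * (t k - y) ^ 2 + τ * K * (y - 1) ^ 2 * q.eval (t k) ^ 2) := by fun_prop
      refine (hc.continuousAt.eventually (lt_mem_nhds ?_)).filter_mono nhdsWithin_le_nhds
      have h1 := hpos k
      have h2 : 0 < (t k - 1) ^ 2 := by
        have := (htI k).2
        have : t k - 1 ≠ 0 := by linarith
        positivity
      have h3 := mul_pos h1 h2
      simp only [sub_self]
      ring_nf at h3 ⊢
      exact h3
    obtain ⟨y, hy, hy1⟩ := (hev.and self_mem_nhdsWithin).exists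
    replace hy1 : 1 < y := hy1
    set A := τ * K * (y - 1) ^ 2 with hA
    have hev' : ∀ x, (wr (p * (X - C y) - C A * q) (q * (X - C y))).eval x =
        w.eval x * (x - y) ^ 2 + A * q.eval x ^ 2 := by
      intro x
      rw [wr_mul_linear]
      simp [hw]
    have h1pos : 0 < τ * (wr (p * (X - C y) - C A * q) (q * (X - C y))).eval 1 := by
      rw [hev']
      have e1 : τ * (w.eval 1 * (1 - y) ^ 2 + A * q.eval 1 ^ 2) =
          (y - 1) ^ 2 * (τ * w.eval 1 + τ ^ 2 * (|w.eval 1| + 1)) := by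
        rw [hA, hK]
        field_simp
        ring
      rw [e1]
      have h2 : 0 < y - 1 := by linarith
      have h3 := neg_abs_le (w.eval 1)
      have h4 := le_abs_self (w.eval 1)
      refine mul_pos (by positivity) ?_
      rcases hτ1 with h | h <;> rw [h] <;> linarith
    set g := wr (p * (X - C y) - C A * q) (q * (X - C y)) with hg
    -- The new point is taken slightly to the left of `1`, since the next induction step again needs
    -- all points less than `1`.
    obtain ⟨s, hs, hst⟩ : ∃ s, 0 < τ * g.eval s ∧ s ∈ Ioo (t (Fin.last _)) 1 := by
      have hc : Continuous fun x => τ * g.eval x := by fun_prop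
      have h1 : ∀ᶠ x in 𝓝[<] (1 : ℝ), 0 < τ * g.eval x :=
        (hc.continuousAt.eventually (lt_mem_nhds h1pos)).filter_mono nhdsWithin_le_nhds
      exact (h1.and (Ioo_mem_nhdsLT (htI _).2)).exists
    refine ⟨y ::ₘ b, p * (X - C y) - C A * q, Fin.snoc (α := fun _ => ℝ) t s, σ,
      by rw [Multiset.card_cons, hbc], ?_, ?_, ?_, ?_, hσ, ?_⟩
    · intro x hx
      rcases Multiset.mem_cons.1 hx with rfl | hx
      · exact hy1
      · exact hb x hx
    · refine (natDegree_sub_le _ _).trans (max_le (natDegree_mul_le.trans ?_)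
        ((natDegree_C_mul_le _ _).trans ?_))
      · have := natDegree_X_sub_C_le y
        omega
      · rw [hq, natDegree_conjQuadMul, hbc]; omega
    · rw [Fin.strictMono_iff_lt_succ]
      intro i
      rw [Fin.snoc_castSucc]
      rcases Fin.eq_castSucc_or_eq_last i with ⟨j, rfl⟩ | rfl
      · rw [Fin.succ_castSucc, Fin.snoc_castSucc]
        exact ht j.castSucc_lt_succ
      · rw [Fin.succ_last, Fin.snoc_last]
        exact hst.1
    · intro k
      rcases Fin.eq_castSucc_or_eq_last k with ⟨j, rfl⟩ | rfl
      · rw [Fin.snoc_castSucc]; exact htI j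
      · rw [Fin.snoc_last]
        exact ⟨(htI _).1.trans hst.1.le, hst.2⟩
    · intro k
      rw [conjQuadMul_cons, ← hq, ← hg]
      rcases Fin.eq_castSucc_or_eq_last k with ⟨j, rfl⟩ | rfl
      · rw [Fin.snoc_castSucc, hev', Fin.val_castSucc]
        exact hy j
      · rw [Fin.snoc_last, Fin.val_last]
        exact hs

/-- A pair of conjugate poles in the open unit disc: an alternance does not imply optimality. -/
theorem exists_alternance_not_isBest {n : ℕ} (hn : 2 ≤ n) {a : ℂ} (ha : a.im ≠ 0)
    (ha1 : ‖a‖ < 1) :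
    ∃ (u : Multiset ℂ) (f : ℝ → ℝ), ContinuousOn f (Icc (-1) 1) ∧ (∀ c ∈ u, 1 < ‖c‖) ∧
      (a ::ₘ (starRingEnd ℂ) a ::ₘ u).card = n ∧
      IsRealValued (a ::ₘ (starRingEnd ℂ) a ::ₘ u) ∧
      HasAlternance (n + 1) f (a ::ₘ (starRingEnd ℂ) a ::ₘ u) ∧
      ¬ IsBest n f (a ::ₘ (starRingEnd ℂ) a ::ₘ u) := by
  obtain ⟨m, rfl⟩ := Nat.exists_eq_add_of_le' hn
  obtain ⟨b, p, t, σ, hbc, hb, hp, ht, htI, hσ, hpos⟩ := exists_oscillating ha ha1 m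
  set q := conjQuadMul a b with hq
  have hqd : q.natDegree = m + 2 := by rw [hq, natDegree_conjQuadMul, hbc]
  have hq0 : ∀ x ∈ Icc (-1 : ℝ) 1, q.eval x ≠ 0 := fun x hx => eval_conjQuadMul_ne_zero ha hb hx
  have hqne : q ≠ 0 := by
    intro h
    rw [h, natDegree_zero] at hqd
    omega
  obtain ⟨k₀, hk₀⟩ := Finite.exists_min fun k => |(wr p q).eval (t k)|
  set η := |(wr p q).eval (t k₀)| with hη
  have hη0 : 0 < η := abs_pos.2 (right_ne_zero_of_mul (hpos k₀).ne')
  -- Clipping gives an error that is `±1` at the points `t k` and that has the sign of `wr p q`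
  -- wherever it is extremal, so `p` is an improving direction.
  set e : ℝ → ℝ := fun x => max (-1) (min 1 ((wr p q).eval x / η)) with he
  set f : ℝ → ℝ := fun x => e x + realFrac q x with hf
  have hec : Continuous e := by fun_prop
  have hfc : ContinuousOn f (Icc (-1) 1) := hec.continuousOn.add (continuousOn_realFrac hq0)
  have hfe : ∀ x, f x - realFrac q x = e x := fun x => add_sub_cancel_right _ _
  have hetk : ∀ k : Fin (m + 3), e (t k) = σ * (-1) ^ (k : ℕ) := by
    intro k
    have h1 := hpos k
    have h2 := hk₀ k
    have hs : σ * (-1) ^ (k : ℕ) = 1 ∨ σ * (-1) ^ (k : ℕ) = -1 := by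
      rcases neg_one_pow_eq_or ℝ (k : ℕ) with h | h <;> rcases hσ with rfl | rfl <;> rw [h] <;> simp
    rcases hs with hs | hs <;> rw [hs] at h1 ⊢
    · rw [one_mul] at h1
      rw [abs_of_pos h1] at h2
      have h3 : 1 ≤ (wr p q).eval (t k) / η := (one_le_div hη0).2 h2
      rw [he]
      simp only
      rw [min_eq_left h3]
      norm_num
    · have h4 : (wr p q).eval (t k) < 0 := by linarith
      rw [abs_of_neg h4] at h2
      have h3 : (wr p q).eval (t k) / η ≤ -1 := by
        rw [div_le_iff₀ hη0]; linarith
      rw [he]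
      simp only
      rw [min_eq_right (by linarith), max_eq_left h3]
  have htI' : ∀ k, t k ∈ Icc (-1 : ℝ) 1 := fun k => Ico_subset_Icc_self (htI k)
  have hdev : deviation f (q.aroots ℂ) = 1 := by
    refine deviation_eq_of hfc hq0 (fun x _ => ?_) (htI' 0) ?_
    · rw [hfe, abs_le]
      exact ⟨le_max_left _ _, max_le (by norm_num) (min_le_left _ _)⟩
    · rw [hfe, hetk]
      rcases hσ with rfl | rfl <;> simp
  have haroots : q.aroots ℂ = a ::ₘ (starRingEnd ℂ) a ::ₘ b.map fun y : ℝ => (y : ℂ) :=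
    aroots_conjQuadMul a b
  refine ⟨b.map fun y : ℝ => (y : ℂ), f, hfc, ?_, ?_⟩
  · intro c hc
    obtain ⟨y, hy, rfl⟩ := Multiset.mem_map.1 hc
    rw [Complex.norm_real, Real.norm_eq_abs]
    exact (hb y hy).trans_le (le_abs_self y)
  · rw [← haroots]
    refine ⟨by rw [card_aroots, hqd], isRealValued_aroots hqne, ?_, ?_⟩
    · rw [hasAlternance_aroots hq0]
      refine ⟨t, ht, htI', σ, hσ, fun k => ?_⟩
      rw [hfe, hetk, hdev, mul_one]
    · refine not_isBest_of_direction hfc hqd.le hq0 hp fun x _ hx => ?_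
      rw [hdev, hfe] at hx
      rw [hfe]
      have h1 : e x = max (-1) (min 1 ((wr p q).eval x / η)) := rfl
      rcases (abs_eq zero_le_one).1 hx with h | h
      · rw [h, one_mul]
        have h2 : 0 < (wr p q).eval x / η := by
          by_contra hcon
          have h3 : e x ≤ 0 := by
            rw [h1]
            exact max_le (by norm_num) ((min_le_right _ _).trans (not_lt.1 hcon))
          linarith
        exact (div_pos_iff_of_pos_right hη0).1 h2
      · rw [h]
        have h2 : (wr p q).eval x / η < 0 := by
          by_contra hcon
          have h3 : 0 ≤ e x := by
            rw [h1]
            exact le_max_of_le_right (le_min zero_le_one (not_lt.1 hcon))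
          linarith
        have h3 : (wr p q).eval x < 0 := by
          by_contra hcon
          exact absurd h2 (not_lt.2 (div_nonneg (not_lt.1 hcon) hη0.le))
        linarith

/-- A pair of conjugate poles on the unit circle: the best approximant need not be unique. -/
theorem exists_isBest_not_unique {a : ℂ} (ha : a.im ≠ 0) (ha1 : ‖a‖ = 1) :
    ∃ f : ℝ → ℝ, ContinuousOn f (Icc (-1) 1) ∧
      HasAlternance 3 f {a, (starRingEnd ℂ) a} ∧ IsBest 2 f {a, (starRingEnd ℂ) a} ∧
      ∃ w : Multiset ℂ, IsBest 2 f w ∧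
        ∃ x ∈ Icc (-1 : ℝ) 1, frac w x ≠ frac {a, (starRingEnd ℂ) a} x := by
  have hβ : a.re ^ 2 + a.im ^ 2 = 1 := by
    have : ‖a‖ ^ 2 = 1 := by rw [ha1, one_pow]
    rw [Complex.sq_norm, Complex.normSq_apply] at this
    linarith
  have him : 0 < a.im ^ 2 := by positivity
  have hre : -1 < a.re ∧ a.re < 1 := by
    constructor <;> nlinarith
  set q := conjQuad a with hq
  have hqm : conjQuadMul a 0 = q := by simp [conjQuadMul, hq]
  have haroots : q.aroots ℂ = {a, (starRingEnd ℂ) a} := by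
    rw [← hqm, aroots_conjQuadMul]; rfl
  have hqd : q.natDegree ≤ 2 := by rw [← hqm, natDegree_conjQuadMul]; rfl
  have hqe : ∀ x, q.eval x = x ^ 2 - 2 * a.re * x + 1 := by
    intro x
    rw [eval_conjQuad, ← hβ]; ring
  have hqge : ∀ x, a.im ^ 2 ≤ q.eval x := by
    intro x
    rw [eval_conjQuad]
    nlinarith [sq_nonneg (x - a.re)]
  have hqpos : ∀ x, 0 < q.eval x := fun x => him.trans_le (hqge x)
  have hq0 : ∀ x ∈ Icc (-1 : ℝ) 1, q.eval x ≠ 0 := fun x _ => (hqpos x).ne'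
  -- Since `q ≥ a.im ^ 2`, half of this constant keeps `p` positive on `[-1, 1]`. The resulting
  -- difference of fractions `g` is nonnegative and vanishes at `±1`.
  set p : ℝ[X] := q + C (a.im ^ 2 / 2) * X with hp
  have hpd : p.natDegree ≤ 2 :=
    natDegree_add_le_of_degree_le hqd ((natDegree_C_mul_le _ _).trans (by simp))
  have hppos : ∀ x ∈ Icc (-1 : ℝ) 1, 0 < p.eval x := by
    intro x hx
    have h1 := hqge x
    have h2 : p.eval x = q.eval x + a.im ^ 2 / 2 * x := by simp [hp]
    rw [h2]
    nlinarith [hx.1]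
  have hp0 : ∀ x ∈ Icc (-1 : ℝ) 1, p.eval x ≠ 0 := fun x hx => (hppos x hx).ne'
  have hwr : ∀ x, (wr p q).eval x = a.im ^ 2 / 2 * (1 - x ^ 2) := by
    intro x
    rw [hp, wr_add, wr_self, wr_C_mul, zero_add, wr, derivative_conjQuad]
    simp only [eval_mul, eval_sub, eval_C, derivative_X, eval_one, eval_X, eval_add, hqe]
    ring
  set g : ℝ → ℝ := fun x => realFrac p x - realFrac q x with hg
  have hge : ∀ x ∈ Icc (-1 : ℝ) 1,
      g x = a.im ^ 2 / 2 * (1 - x ^ 2) / (p.eval x * q.eval x) := by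
    intro x hx
    rw [← hwr]
    exact realFrac_sub_realFrac (hp0 x hx) (hq0 x hx)
  have hgc : ContinuousOn g (Icc (-1) 1) :=
    (continuousOn_realFrac hp0).sub (continuousOn_realFrac hq0)
  have hgnn : ∀ x ∈ Icc (-1 : ℝ) 1, 0 ≤ g x := by
    intro x hx
    rw [hge x hx]
    have h1 := hppos x hx
    have h2 := hqpos x
    have h3 : 0 ≤ 1 - x ^ 2 := by nlinarith [hx.1, hx.2]
    positivity
  have h0I : (0 : ℝ) ∈ Icc (-1 : ℝ) 1 := by norm_num
  have h1I : (1 : ℝ) ∈ Icc (-1 : ℝ) 1 := by norm_num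
  have hm1I : (-1 : ℝ) ∈ Icc (-1 : ℝ) 1 := by norm_num
  have hg0 : 0 < g 0 := by
    rw [hge 0 h0I]
    have h1 := hppos 0 h0I
    have h2 := hqpos 0
    norm_num
    positivity
  have hg1 : g 1 = 0 := by rw [hge 1 h1I]; norm_num
  have hgm1 : g (-1) = 0 := by rw [hge (-1) hm1I]; norm_num
  obtain ⟨y, hyI, hy⟩ := isCompact_Icc.exists_isMaxOn (nonempty_Icc.2 (by norm_num)) hgc
  have hymax : ∀ x ∈ Icc (-1 : ℝ) 1, g x ≤ g y := fun x hx => hy hx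
  have hgy : 0 < g y := hg0.trans_le (hymax 0 h0I)
  set δ := g y / 2 with hδ
  have hδ0 : 0 < δ := by positivity
  -- The error of `p` is the constant `-δ`, and that of `q` is `g - δ`, which runs from `-δ` at `±1`
  -- to `δ` at the maximum of `g`.
  set f : ℝ → ℝ := fun x => realFrac p x - δ with hf
  have hfc : ContinuousOn f (Icc (-1) 1) := (continuousOn_realFrac hp0).sub continuousOn_const
  have hfp : ∀ x, f x - realFrac p x = -δ := fun x => by simp only [hf]; ring
  have hfq : ∀ x, f x - realFrac q x = g x - δ := fun x => by simp only [hf, hg]; ring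
  have hdp : deviation f (p.aroots ℂ) = δ := by
    refine deviation_eq_of hfc hp0 (fun x _ => ?_) h0I ?_
    · rw [hfp, abs_neg, abs_of_pos hδ0]
    · rw [hfp, abs_neg, abs_of_pos hδ0]
  have hdq : deviation f (q.aroots ℂ) = δ := by
    refine deviation_eq_of hfc hq0 (fun x hx => ?_) h1I ?_
    · rw [hfq, abs_le]
      have h1 := hgnn x hx
      have h2 := hymax x hx
      constructor <;> linarith
    · rw [hfq, hg1, zero_sub, abs_neg, abs_of_pos hδ0]
  -- A better fraction would lie below `q'/q` at both `1` and `-1`. But there `wr s q` equals `s₂ -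
  -- s₀`, respectively `s₀ - s₂`, times a positive factor, so the signs cannot agree.
  have hlower : ∀ w, IsAdmissible 2 w → δ ≤ deviation f w := by
    intro w hw
    obtain ⟨s, -, rfl, hsd, hs0⟩ := hw.exists_poly
    by_contra! hlt
    obtain ⟨σ, hσ, hσpos⟩ := exists_sign hs0
    have key : ∀ x ∈ Icc (-1 : ℝ) 1, g x = 0 → σ * (wr s q).eval x < 0 := by
      intro x hx hgx
      have h1 := (abs_lt.1 ((abs_le_deviation hfc hs0 hx).trans_lt hlt)).1
      have h2 := hfq x
      rw [hgx] at h2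
      have h3 : realFrac s x - realFrac q x < 0 := by linarith
      rw [realFrac_sub_realFrac (hs0 x hx) (hq0 x hx)] at h3
      have h4 := hσpos x hx
      have h5 : (wr s q).eval x / (s.eval x * q.eval x) * ((σ * s.eval x) * q.eval x) < 0 :=
        mul_neg_of_neg_of_pos h3 (mul_pos h4 (hqpos x))
      have h6 : (wr s q).eval x / (s.eval x * q.eval x) * ((σ * s.eval x) * q.eval x) =
          σ * (wr s q).eval x := by
        have := hs0 x hx
        have := hq0 x hx
        field_simp
      rwa [h6] at h5
    have hs : s = C (s.coeff 2) * X ^ 2 + C (s.coeff 1) * X + C (s.coeff 0) :=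
      eq_quadratic_of_degree_le_two (natDegree_le_iff_degree_le.1 hsd)
    have hwe : ∀ x, (wr s q).eval x = (2 * s.coeff 2 * x + s.coeff 1) * q.eval x -
        (s.coeff 2 * x ^ 2 + s.coeff 1 * x + s.coeff 0) * (2 * x - 2 * a.re) := by
      intro x
      conv_lhs => rw [hs]
      rw [wr, derivative_conjQuad]
      simp only [eval_sub, eval_mul, eval_add, eval_C, eval_X, eval_pow, derivative_add,
        derivative_mul, derivative_C, derivative_X, derivative_X_pow, zero_mul, zero_add, eval_one,
        eval_zero, Nat.cast_ofNat]
      norm_num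
      ring
    have k1 := key 1 h1I hg1
    have k2 := key (-1) hm1I hgm1
    rw [hwe, hqe] at k1 k2
    have e1 : 0 < 2 - 2 * a.re := by linarith [hre.2]
    have e2 : 0 < 2 + 2 * a.re := by linarith [hre.1]
    have k1' : (σ * (s.coeff 2 - s.coeff 0)) * (2 - 2 * a.re) < 0 := by
      refine lt_of_eq_of_lt ?_ k1
      ring
    have k2' : -(σ * (s.coeff 2 - s.coeff 0)) * (2 + 2 * a.re) < 0 := by
      refine lt_of_eq_of_lt ?_ k2
      ring
    have k3 := (neg_iff_pos_of_mul_neg k1').2 e1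
    have k4 := (neg_iff_pos_of_mul_neg k2').2 e2
    linarith
  rw [← haroots]
  refine ⟨f, hfc, ?_, ⟨isAdmissible_aroots hqd hq0, fun w hw => hdq ▸ hlower w hw⟩, p.aroots ℂ,
    ⟨isAdmissible_aroots hpd hp0, fun w hw => hdp ▸ hlower w hw⟩, 0, h0I, ?_⟩
  · rw [hasAlternance_aroots hq0]
    have hy1 : y < 1 := lt_of_le_of_ne hyI.2 (by rintro rfl; exact hgy.ne' hg1)
    have hym1 : -1 < y := lt_of_le_of_ne hyI.1 (by rintro rfl; exact hgy.ne' hgm1)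
    refine ⟨![-1, y, 1], ?_, ?_, -1, Or.inr rfl, ?_⟩
    · rw [Fin.strictMono_iff_lt_succ]
      intro i
      fin_cases i
      · simpa using hym1
      · simpa using hy1
    · intro k
      fin_cases k
      · exact hm1I
      · exact hyI
      · exact h1I
    · intro k
      rw [hfq, hdq]
      fin_cases k
      · simp [hgm1]
      · simp [hδ]; ring
      · simp [hg1]
  · have h1 := frac_aroots p (hp0 0 h0I)
    have h2 := frac_aroots q (hq0 0 h0I)
    rw [h1, h2]
    intro h
    have : realFrac p 0 = realFrac q 0 := by exact_mod_cast h
    have : g 0 = 0 := by simp only [hg]; rw [this, sub_self]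
    exact hg0.ne' this

/-- Alternance criterion and uniqueness for poles outside the closed unit disc. -/
theorem isBest_iff_and_unique {n : ℕ} {f : ℝ → ℝ} {z : Multiset ℂ}
    (hf : ContinuousOn f (Icc (-1) 1)) (hz : IsRealValued z) (hc : z.card = n)
    (hout : ∀ a ∈ z, 1 < ‖a‖) :
    (IsBest n f z ↔ HasAlternance (n + 1) f z) ∧
      (IsBest n f z → ∀ w : Multiset ℂ, IsBest n f w → w = z) := by
  obtain ⟨q, hqm, rfl⟩ := exists_real_poly hz
  have hq : IsMonicOfDegree q n := ⟨by rw [← hc, card_aroots], hqm⟩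
  have hroot : ∀ a : ℂ, aeval a q = 0 → 1 < ‖a‖ := fun a ha =>
    hout a (mem_aroots.2 ⟨hqm.ne_zero, ha⟩)
  have hq0 : ∀ x ∈ Icc (-1 : ℝ) 1, q.eval x ≠ 0 := fun x hx => eval_ne_zero_of_roots hroot hx
  have key : HasAlternance (n + 1) f (q.aroots ℂ) → ∀ w, IsAdmissible n w →
      deviation f w ≤ deviation f (q.aroots ℂ) → w = q.aroots ℂ := by
    intro halt w hw hle
    obtain ⟨p, hpm, rfl, hpd, hp0⟩ := hw.exists_poly
    rw [eq_of_alternance hf hq hroot halt hpm hpd hp0 hle]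
  have hnec : IsBest n f (q.aroots ℂ) → HasAlternance (n + 1) f (q.aroots ℂ) :=
    hasAlternance_of_isBest hf hq hroot
  refine ⟨⟨hnec, fun halt => ⟨isAdmissible_aroots hq.natDegree_eq.le hq0, fun w hw => ?_⟩⟩,
    fun hb w hw => key (hnec hb) w hw.1 (hw.2 _ hb.1)⟩
  by_contra! hlt
  exact hlt.ne (by rw [key halt w hw hlt.le])

end SimpleFraction

end

theorem mainTheorem3 :
    -- criterion and uniqueness
    (∀ (n : ℕ) (f : ℝ → ℝ) (z : Multiset ℂ), ContinuousOn f (Set.Icc (-1) 1) →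
      SimpleFraction.IsRealValued z → z.card = n → (∀ a ∈ z, 1 < ‖a‖) →
      (SimpleFraction.IsBest n f z ↔ SimpleFraction.HasAlternance (n + 1) f z) ∧
      (SimpleFraction.IsBest n f z → ∀ w : Multiset ℂ, SimpleFraction.IsBest n f w → w = z)) ∧
    -- a single pair of conjugate poles in the open disc: the alternance may not suffice
    (∀ n : ℕ, 2 ≤ n → ∀ z₀ : ℂ, z₀.im ≠ 0 → ‖z₀‖ < 1 →
      ∃ (u : Multiset ℂ) (f : ℝ → ℝ), ContinuousOn f (Set.Icc (-1) 1) ∧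
        (∀ a ∈ u, 1 < ‖a‖) ∧
        (z₀ ::ₘ (starRingEnd ℂ) z₀ ::ₘ u).card = n ∧
        SimpleFraction.IsRealValued (z₀ ::ₘ (starRingEnd ℂ) z₀ ::ₘ u) ∧
        SimpleFraction.HasAlternance (n + 1) f (z₀ ::ₘ (starRingEnd ℂ) z₀ ::ₘ u) ∧
        ¬ SimpleFraction.IsBest n f (z₀ ::ₘ (starRingEnd ℂ) z₀ ::ₘ u)) ∧
    -- a pair of conjugate poles on the unit circle: uniqueness may fail
    (∀ z₀ : ℂ, z₀.im ≠ 0 → ‖z₀‖ = 1 →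
      ∃ f : ℝ → ℝ, ContinuousOn f (Set.Icc (-1) 1) ∧
        SimpleFraction.HasAlternance 3 f {z₀, (starRingEnd ℂ) z₀} ∧
        SimpleFraction.IsBest 2 f {z₀, (starRingEnd ℂ) z₀} ∧
        ∃ w : Multiset ℂ, SimpleFraction.IsBest 2 f w ∧
          ∃ x ∈ Set.Icc (-1 : ℝ) 1,
            SimpleFraction.frac w x ≠ SimpleFraction.frac {z₀, (starRingEnd ℂ) z₀} x) := by
  exact ⟨fun _ _ _ hf hz hc hout => SimpleFraction.isBest_iff_and_unique hf hz hc hout,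
    fun _ hn _ ha ha1 => SimpleFraction.exists_alternance_not_isBest hn ha ha1,
    fun _ ha ha1 => SimpleFraction.exists_isBest_not_unique ha ha1⟩
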